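/- Let $n\ge 1$ and $\beta\in(0,1)$. Let $$p(t,x,y)=\frac{c(n)\,t}{(t^2+|x-y|^2)^{(n+1)/2}},\qquad c(n)=\pi^{-(n+1)/2}\,\Gamma\!\left(\tfrac{n+1}{2}\right),\qquad t>0,\ x,y\in\mathbb R^n,$$ be the Cauchy (Poisson) kernel on $\mathbb R^n$. Let $S=(S_t)_{t\ge0}$ be a $\beta$-stable subordinator, i.e. a non-decreasing Lévy process on $[0,\infty)$ with $\mathbb E\,e^{-rS_t}=e^{-tr^\beta}$ for $r>0$, $t\ge0$, and let $S^{-1}_t=\inf\{s\ge0: S_s>t\}$ be its generalized right-continuous inverse. Define $$p^{S}(t,x,y)=\int_0^\infty p(s,x,y)\,d_s\mathbb P(S_t\le s),\qquad p^{S^{-1}}(t,x,y)=\int_0^\infty p(s,x,y)\,d_s\mathbb P(S^{-1}_t\le s).$$ For a positive function $A$ of $(t,x,y)$, "$f\sim g$ as $A\to\infty$" means that for every $\varepsilon>0$ there is an $R>0$ with $|f/g-1|\le\varepsilon$ for all $(t,x,y)$ with $t>0$ and $A(t,x,y)\ge R$; similarly for $A\to0$. Then: (a) As $|x-y|\,t^{-1/\beta}\to\infty$,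 $$p^S(t,x,y)\sim\frac{\beta\,2^{\beta-1}\,\Gamma\!\left(\frac{n+\beta}{2}\right)}{\pi^{n/2}\,\Gamma\!\left(1-\frac{\beta}{2}\right)}\,|x-y|^{-n-\beta}\,t.$$ (b) As $|x-y|\,t^{-1/\beta}\to0$ (the case $x=y$ included), $$p^S(t,x,y)\sim\frac{\Gamma\!\left(\frac{n+1}{2}\right)\Gamma\!\left(\frac{n}{\beta}\right)}{\beta\,\pi^{(n+1)/2}\,\Gamma(n)}\,t^{-n/\beta}.$$ (c) As $|x-y|^{-1/\beta}\,t\to\infty$, with $x\ne y$, $$p^{S^{-1}}(t,x,y)\sim\begin{cases}\dfrac{\beta}{\pi\,\Gamma(1-\beta)}\,t^{-\beta}\log\!\left[|x-y|^{-1/\beta}\,t\right], & n=1,\\[2ex] \dfrac{\Gamma\!\left(\frac{n-1}{2}\right)}{2\,\pi^{(n+1)/2}\,\Gamma(1-\beta)}\,|x-y|^{1-n}\,t^{-\beta}, & n\ge2.\end{cases}$$ (d) As $|x-y|^{-1/\beta}\,t\to0$, with $x\ne y$, $$p^{S^{-1}}(t,x,y)\sim\frac{\Gamma\!\left(\frac{n+1}{2}\right)}{\pi^{(n+1)/2}\,\beta\,\Gamma(\beta)}\,|x-y|^{-n-1}\,t^{\beta}.$$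 -/

import Mathlib

open MeasureTheory ProbabilityTheory Filter Topology Asymptotics
open scoped NNReal

noncomputable section

/-- `S` is a `β`-stable subordinator under `P`: a Lévy process with non-decreasing,
right-continuous paths started at `0`, whose Laplace transform is
`E exp (-r S_t) = exp (-t r ^ β)`.  (Monotone paths automatically have left limits, and
paths started at `0` that are non-decreasing take values in `[0, ∞)`.) -/
structure IsStableSubordinator {Ω : Type*} [MeasurableSpace Ω] (P : Measure Ω)
    (β : ℝ) (S : ℝ≥0 → Ω → ℝ) : Prop where
  measurable : ∀ t, Measurable (S t)
  start_zero : ∀ᵐ ω ∂P, S 0 ω = 0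
  monotone_paths : ∀ᵐ ω ∂P, Monotone fun t => S t ω
  rightCont_paths : ∀ᵐ ω ∂P, ∀ t, ContinuousWithinAt (fun s => S s ω) (Set.Ici t) t
  indep_increments : HasIndepIncrements S P
  stationary_increments : ∀ s t : ℝ≥0,
    IdentDistrib (fun ω => S (s + t) ω - S s ω) (S t) P P
  laplace : ∀ (t : ℝ≥0) (r : ℝ), 0 < r →
    ∫ ω, Real.exp (-r * S t ω) ∂P = Real.exp (-(t : ℝ) * r ^ β)

/-- The generalized right-continuous inverse `S⁻¹_t = inf {s ≥ 0 : S_s > t}`. -/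
def inverseProcess {Ω : Type*} (S : ℝ≥0 → Ω → ℝ) (t : ℝ≥0) (ω : Ω) : ℝ :=
  ((sInf {s : ℝ≥0 | (t : ℝ) < S s ω} : ℝ≥0) : ℝ)

/-- The kernel of the time-changed process:
`p^T (t, x, y) = ∫_{(0, ∞)} p (s, x, y) d_s P(T_t ≤ s)`, that is, the integral of
`s ↦ p (s, x, y)` against the law of `T_t`. -/
def timeChangedKernel {Ω E : Type*} [MeasurableSpace Ω] (P : Measure Ω)
    (p : ℝ → E → E → ℝ) (T : ℝ≥0 → Ω → ℝ) (t : ℝ≥0) (x y : E) : ℝ :=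
  ∫ s in Set.Ioi (0 : ℝ), p s x y ∂(P.map (T t))

/-- The Cauchy (Poisson) kernel on `ℝⁿ`:
`p (t, x, y) = c(n) t / (t² + |x - y|²) ^ ((n + 1) / 2)` with
`c(n) = π ^ (-(n + 1) / 2) Γ((n + 1) / 2)`. -/
def cauchyKernel (n : ℕ) (t : ℝ) (x y : EuclideanSpace ℝ (Fin n)) : ℝ :=
  Real.pi ^ (-((n : ℝ) + 1) / 2) * Real.Gamma (((n : ℝ) + 1) / 2) * t /
    (t ^ 2 + ‖x - y‖ ^ 2) ^ (((n : ℝ) + 1) / 2)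

/-- The filter on triples `(t, x, y)` with `t > 0` along which `A (t, x, y)` tends to `l`. -/
def alongTime {E : Type*} (A : ℝ≥0 × E × E → ℝ) (l : Filter ℝ) : Filter (ℝ≥0 × E × E) :=
  comap A l ⊓ 𝓟 {q | 0 < q.1}

/-- The filter on triples `(t, x, y)` with `t > 0` and `x ≠ y` along which `A (t, x, y)`
tends to `l`. -/
def alongTimeOffDiag {E : Type*} (A : ℝ≥0 × E × E → ℝ) (l : Filter ℝ) :
    Filter (ℝ≥0 × E × E) :=
  comap A l ⊓ 𝓟 {q | 0 < q.1 ∧ q.2.1 ≠ q.2.2}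

end

/-!
Everything reduces to one probability measure on the half-line, the law `μ` of `X = S 1`, whose
Laplace transform is `exp (-r ^ β)`. Uniqueness of Laplace transforms gives
`S t = t ^ (1 / β) * X` in law. Up to null sets, `{S⁻¹ t > s}` for the inverse process `S⁻¹` is the
increasing union of the events `{S (s + 1 / (k + 1)) ≤ t}`, so `S⁻¹ t = (t / X) ^ β` in law. The
Cauchy kernel is a constant multiple of the homogeneous function
`poissonProfile d δ s = s / (s ^ 2 + δ ^ 2) ^ ((d + 1) / 2)`. Hence both kernels are explicit
powers of `t` times `E[poissonProfile d δ X]` or `E[poissonProfile d δ (X ^ (-β))]`, where `δ` is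
the scaling variable, and all four regimes are limits in `δ` alone.

* For `X` and `δ → 0`, dominated convergence gives the negative moment `E[X ^ (-d)]`, which is
  computed by integrating the Laplace transform against `r ^ (d - 1)`
  (`IsStableLaw.integrable_rpow_neg_and_integral`). For `X ^ (-β)` and `δ → ∞` the limit is the
  moment `E[X ^ (-β)]` for the same reason.
* The other two regimes depend on the tail `u ^ β * P(X > u) → 1 / Γ(1 - β)`
  (`IsStableLaw.tendsto_tail`). This is a Tauberian statement: the rescaled tails are antitone and
  their Laplace transforms converge, so by Weierstrass approximation they converge against every
  continuous function of `exp (-v)`, and testing against bumps on either side of a continuity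
  point gives pointwise convergence (`tendsto_of_antitoneOn_of_laplace`).
* For `X` and `δ → ∞`, Fubini writes the expectation as the integral of the derivative of the
  profile against the rescaled tail, and dominated convergence applies; the limit is a beta
  integral, brought to the stated form by Legendre's duplication formula.
* For `X ^ (-β)` and `δ → 0`, the tail says that the distribution function of `X ^ (-β)` is
  asymptotic to `s / Γ(1 - β)` at `0`. Comparing with the uniform law on `(0, 1]` shows that the
  expectation is asymptotic to `1 / Γ(1 - β)` times `∫ s in (0, 1], poissonProfile d δ s`
  (`tendsto_integral_poissonProfile_div`); that integral is logarithmic for `d = 1` and a power of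
  `δ` for `d > 1`, which is the source of the dichotomy between dimension one and higher
  dimensions.
-/

/-! ### Laplace transforms and weak convergence on the half-line -/

/-- On the half-line, convergence of the Laplace transforms at all natural numbers implies
convergence of the integrals of every continuous function of `exp (-x)`, because polynomials are
dense in the continuous functions on `[0, 1]`. -/
theorem tendsto_integral_comp_exp_neg {ι : Type*} {l : Filter ι} {m : ι → Measure ℝ}
    {m₀ : Measure ℝ} [∀ i, IsFiniteMeasure (m i)] [IsFiniteMeasure m₀]
    (hm : ∀ i, ∀ᵐ x ∂m i, 0 ≤ x) (hm₀ : ∀ᵐ x ∂m₀, 0 ≤ x)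
    (h : ∀ k : ℕ, Tendsto (fun i => ∫ x, Real.exp (-(k * x)) ∂m i) l
      (𝓝 (∫ x, Real.exp (-(k * x)) ∂m₀)))
    {f : ℝ → ℝ} (hf : Continuous f) :
    Tendsto (fun i => ∫ x, f (Real.exp (-x)) ∂m i) l (𝓝 (∫ x, f (Real.exp (-x)) ∂m₀)) := by
  -- on a measure carried by `[0, ∞)` all functions `f (exp (-x))` are bounded
  have hint : ∀ (ν : Measure ℝ) [IsFiniteMeasure ν], (∀ᵐ x ∂ν, 0 ≤ x) → ∀ g : ℝ → ℝ,
      Continuous g → Integrable (fun x => g (Real.exp (-x))) ν := by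
    intro ν _ hν g hg
    obtain ⟨C, hC⟩ := isCompact_Icc.exists_bound_of_continuousOn (s := Set.Icc (0 : ℝ) 1)
      hg.continuousOn
    refine Integrable.of_bound (C := C) ?_ ?_
    · exact (hg.comp (by fun_prop)).aestronglyMeasurable
    · filter_upwards [hν] with x hx
      exact hC _ ⟨(Real.exp_pos _).le, by simpa using hx⟩
  have hpoly : ∀ p : Polynomial ℝ, Tendsto (fun i => ∫ x, p.eval (Real.exp (-x)) ∂m i) l
      (𝓝 (∫ x, p.eval (Real.exp (-x)) ∂m₀)) := by
    intro p
    have key : ∀ (ν : Measure ℝ) [IsFiniteMeasure ν], (∀ᵐ x ∂ν, 0 ≤ x) →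
        ∫ x, p.eval (Real.exp (-x)) ∂ν
          = ∑ k ∈ Finset.range (p.natDegree + 1), p.coeff k * ∫ x, Real.exp (-(k * x)) ∂ν := by
      intro ν _ hν
      have h1 : ∀ x : ℝ, p.eval (Real.exp (-x))
          = ∑ k ∈ Finset.range (p.natDegree + 1), p.coeff k * Real.exp (-(k * x)) := by
        intro x
        rw [Polynomial.eval_eq_sum_range]
        refine Finset.sum_congr rfl fun k _ => ?_
        rw [← Real.exp_nat_mul]
        ring_nf
      simp_rw [h1]
      rw [integral_finsetSum]
      · simp_rw [integral_const_mul]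
      · intro k _
        refine Integrable.const_mul ?_ _
        refine (hint ν hν (fun u => u ^ k) (by fun_prop)).congr (ae_of_all _ fun x => ?_)
        simp only
        rw [← Real.exp_nat_mul]
        ring_nf
    simp_rw [key m₀ hm₀, fun i => key (m i) (hm i)]
    exact tendsto_finsetSum _ fun k _ => (h k).const_mul _
  have hmass : Tendsto (fun i => (m i).real Set.univ) l (𝓝 (m₀.real Set.univ)) := by
    simpa using h 0
  -- the total masses stay below `B`, so a uniform approximation costs at most `ε / 3` twice
  set B := m₀.real Set.univ + 1 with hB
  have hBpos : 0 < B := by positivity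
  rw [Metric.tendsto_nhds]
  intro ε hε
  obtain ⟨p, hp⟩ := exists_polynomial_near_of_continuousOn 0 1 f hf.continuousOn
    (ε / (3 * B)) (by positivity)
  have happ : ∀ (ν : Measure ℝ) [IsFiniteMeasure ν], (∀ᵐ x ∂ν, 0 ≤ x) → ν.real Set.univ ≤ B →
      |∫ x, p.eval (Real.exp (-x)) ∂ν - ∫ x, f (Real.exp (-x)) ∂ν| ≤ ε / 3 := by
    intro ν _ hν hνB
    have h1 := hint ν hν _ p.continuous
    have h2 := hint ν hν _ hf
    rw [← integral_sub h1 h2]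
    have h3 : ‖∫ x, (p.eval (Real.exp (-x)) - f (Real.exp (-x))) ∂ν‖
        ≤ ε / (3 * B) * ν.real Set.univ := by
      refine norm_integral_le_of_norm_le_const ?_
      filter_upwards [hν] with x hx
      exact (hp _ ⟨(Real.exp_pos _).le, by simpa using hx⟩).le
    calc _ ≤ ε / (3 * B) * ν.real Set.univ := h3
      _ ≤ ε / (3 * B) * B := by gcongr
      _ = ε / 3 := by field_simp
  filter_upwards [hmass.eventually_lt_const (show _ < B by linarith),
    Metric.tendsto_nhds.1 (hpoly p) (ε / 3) (by positivity)] with i hi hpi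
  have h1 := happ (m i) (hm i) hi.le
  have h2 := happ m₀ hm₀ (by linarith)
  rw [Real.dist_eq] at hpi ⊢
  rw [abs_le] at h1 h2
  rw [abs_lt] at hpi ⊢
  constructor <;> linarith [h1.1, h1.2, h2.1, h2.2, hpi.1, hpi.2]

/-- A probability measure on the half-line is determined by its Laplace transform. -/
theorem MeasureTheory.Measure.ext_of_laplace {μ ν : Measure ℝ} [IsProbabilityMeasure μ]
    [IsProbabilityMeasure ν] (hμ : ∀ᵐ x ∂μ, 0 ≤ x) (hν : ∀ᵐ x ∂ν, 0 ≤ x)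
    (h : ∀ r : ℝ, 0 < r → ∫ x, Real.exp (-r * x) ∂μ = ∫ x, Real.exp (-r * x) ∂ν) : μ = ν := by
  have key : ∀ f : ℝ → ℝ, Continuous f →
      ∫ x, f (Real.exp (-x)) ∂μ = ∫ x, f (Real.exp (-x)) ∂ν := by
    intro f hf
    refine tendsto_nhds_unique (tendsto_const_nhds (f := (⊤ : Filter Unit)))
      (tendsto_integral_comp_exp_neg (m := fun _ => μ) (m₀ := ν) (fun _ => hμ) hν ?_ hf)
    intro k
    have : ∫ x, Real.exp (-(k * x)) ∂μ = ∫ x, Real.exp (-(k * x)) ∂ν := by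
      rcases Nat.eq_zero_or_pos k with rfl | hk
      · simp
      · simpa using h k (by exact_mod_cast hk)
    rw [this]
    exact tendsto_const_nhds
  have hme : Measurable fun x : ℝ => Real.exp (-x) := by fun_prop
  have hmap : μ.map (fun x => Real.exp (-x)) = ν.map (fun x => Real.exp (-x)) := by
    refine ext_of_forall_integral_eq_of_IsFiniteMeasure fun f => ?_
    rw [integral_map hme.aemeasurable f.continuous.aestronglyMeasurable,
      integral_map hme.aemeasurable f.continuous.aestronglyMeasurable]
    exact key f f.continuous
  -- the map `x ↦ exp (-x)` is injective, so the image measures determine the measures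
  have hinv : ∀ ρ : Measure ℝ, (ρ.map fun x => Real.exp (-x)).map (fun u => -Real.log u) = ρ := by
    intro ρ
    rw [Measure.map_map (by fun_prop) hme]
    convert Measure.map_id
    ext x
    simp
  rw [← hinv μ, hmap, hinv]

theorem exists_bump_comp_exp_neg {b c : ℝ} (hb : 0 < b) (hbc : b < c) :
    ∃ f : ℝ → ℝ, Continuous f ∧ (∀ u, 0 ≤ f u) ∧
      (∀ v, v ∉ Set.Icc b c → f (Real.exp (-v)) = 0) ∧
      0 < ∫ v in Set.Ioi (0 : ℝ), f (Real.exp (-v)) * Real.exp (-v) := by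
  refine ⟨fun u => max 0 ((u - Real.exp (-c)) * (Real.exp (-b) - u)), by fun_prop,
    fun u => le_max_left _ _, ?_, ?_⟩
  · intro v hv
    refine max_eq_left ?_
    rw [Set.mem_Icc, not_and_or, not_le, not_le] at hv
    rcases hv with hv | hv
    · have h1 : Real.exp (-b) < Real.exp (-v) := by simpa using hv
      have h2 : Real.exp (-c) < Real.exp (-b) := by simpa using hbc
      nlinarith
    · have h1 : Real.exp (-v) < Real.exp (-c) := by simpa using hv
      have h2 : Real.exp (-c) < Real.exp (-b) := by simpa using hbc
      nlinarith
  · have hpos : ∀ v ∈ Set.Ioo b c,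
        0 < (Real.exp (-v) - Real.exp (-c)) * (Real.exp (-b) - Real.exp (-v)) := by
      intro v hv
      refine mul_pos ?_ ?_
      · have : Real.exp (-c) < Real.exp (-v) := by simpa using hv.2
        linarith
      · have : Real.exp (-v) < Real.exp (-b) := by simpa using hv.1
        linarith
    have hcont : Continuous fun v : ℝ =>
        max 0 ((Real.exp (-v) - Real.exp (-c)) * (Real.exp (-b) - Real.exp (-v)))
          * Real.exp (-v) := by fun_prop
    have h0 : (0 : ℝ) < ∫ v in b..c,
        max 0 ((Real.exp (-v) - Real.exp (-c)) * (Real.exp (-b) - Real.exp (-v)))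
          * Real.exp (-v) := by
      refine intervalIntegral.intervalIntegral_pos_of_pos_on (hcont.intervalIntegrable _ _) ?_ hbc
      intro v hv
      exact mul_pos (lt_max_of_lt_right (hpos v hv)) (Real.exp_pos _)
    rw [intervalIntegral.integral_of_le hbc.le] at h0
    refine h0.trans_le (setIntegral_mono_set ?_ ?_ ?_)
    · have : IntegrableOn (fun v : ℝ => Real.exp (-v)) (Set.Ioi 0) := by
        simpa using integrableOn_exp_mul_Ioi (a := -1) (by norm_num) 0
      refine Integrable.bdd_mul (c := 1) this (Continuous.aestronglyMeasurable (by fun_prop)) ?_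
      refine (ae_restrict_iff' measurableSet_Ioi).2 (ae_of_all _ fun v hv => ?_)
      rw [Real.norm_of_nonneg (le_max_left _ _)]
      refine max_le zero_le_one ?_
      have h1 : Real.exp (-v) ≤ 1 := by simpa using (le_of_lt hv)
      have h2 : Real.exp (-b) ≤ 1 := by simpa using hb.le
      have h3 := Real.exp_pos (-v)
      have h4 := Real.exp_pos (-c)
      rcases le_total (Real.exp (-b)) (Real.exp (-v)) with h | h
      · have h5 := Real.exp_lt_exp.2 (neg_lt_neg hbc)
        rcases le_total (Real.exp (-c)) (Real.exp (-v)) with h' | h' <;> nlinarith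
      · nlinarith
    · exact ae_of_all _ fun v => mul_nonneg (le_max_left _ _) (Real.exp_pos _).le
    · exact (Set.Ioc_subset_Ioi_self.trans (Set.Ioi_subset_Ioi hb.le)).eventuallyLE

/-! ### A Tauberian theorem for antitone functions -/

/-- Convergence of the Laplace transforms of antitone functions implies pointwise convergence at
the continuity points of the limit: near such a point an antitone function is controlled from
either side by its averages against a bump. -/
theorem tendsto_of_antitoneOn_of_laplace {ι : Type*} {l : Filter ι} {T : ι → ℝ → ℝ}
    {T₀ : ℝ → ℝ} (hT : ∀ i, AntitoneOn (T i) (Set.Ioi 0))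
    (hnn : ∀ i, ∀ v, 0 < v → 0 ≤ T i v) (hnn₀ : ∀ v, 0 < v → 0 ≤ T₀ v)
    (hint : ∀ i, IntegrableOn (fun v => Real.exp (-v) * T i v) (Set.Ioi 0))
    (hint₀ : IntegrableOn (fun v => Real.exp (-v) * T₀ v) (Set.Ioi 0))
    (h : ∀ r : ℝ, 0 < r → Tendsto (fun i => ∫ v in Set.Ioi 0, Real.exp (-(r * v)) * T i v) l
      (𝓝 (∫ v in Set.Ioi 0, Real.exp (-(r * v)) * T₀ v)))
    {a : ℝ} (ha : 0 < a) (hcont : ContinuousAt T₀ a) :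
    Tendsto (fun i => T i a) l (𝓝 (T₀ a)) := by
  -- the measure with density `exp (-v) * U v` on the half-line
  let M : (ℝ → ℝ) → Measure ℝ := fun U =>
    (volume.restrict (Set.Ioi 0)).withDensity fun v => ENNReal.ofReal (Real.exp (-v) * U v)
  have hMint : ∀ U : ℝ → ℝ, (∀ v, 0 < v → 0 ≤ U v) →
      IntegrableOn (fun v => Real.exp (-v) * U v) (Set.Ioi 0) → ∀ g : ℝ → ℝ,
      ∫ v, g v ∂M U = ∫ v in Set.Ioi 0, g v * (Real.exp (-v) * U v) := by
    intro U hU hUi g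
    rw [integral_withDensity_eq_integral_toReal_smul₀ hUi.aemeasurable.ennreal_ofReal
      (ae_of_all _ fun _ => ENNReal.ofReal_lt_top)]
    refine setIntegral_congr_fun measurableSet_Ioi fun v hv => ?_
    simp only [smul_eq_mul]
    rw [ENNReal.toReal_ofReal (mul_nonneg (Real.exp_pos _).le (hU v hv)), mul_comm]
  have hMfin : ∀ U : ℝ → ℝ, IntegrableOn (fun v => Real.exp (-v) * U v) (Set.Ioi 0) →
      IsFiniteMeasure (M U) := fun U hU => isFiniteMeasure_withDensity_ofReal hU.2
  have hMpos : ∀ U : ℝ → ℝ, ∀ᵐ v ∂M U, 0 ≤ v := by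
    intro U
    refine (withDensity_absolutelyContinuous _ _).ae_le ?_
    refine (ae_restrict_iff' measurableSet_Ioi).2 (ae_of_all _ fun v hv => le_of_lt hv)
  have hlim : ∀ f : ℝ → ℝ, Continuous f →
      Tendsto (fun i => ∫ v in Set.Ioi 0, f (Real.exp (-v)) * (Real.exp (-v) * T i v)) l
        (𝓝 (∫ v in Set.Ioi 0, f (Real.exp (-v)) * (Real.exp (-v) * T₀ v))) := by
    intro f hf
    have hfin : ∀ i, IsFiniteMeasure (M (T i)) := fun i => hMfin _ (hint i)
    have hfin₀ : IsFiniteMeasure (M T₀) := hMfin _ hint₀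
    have := tendsto_integral_comp_exp_neg (l := l) (m := fun i => M (T i)) (m₀ := M T₀)
      (fun i => hMpos _) (hMpos _) ?_ hf
    · simpa only [hMint _ hnn₀ hint₀, fun i => hMint _ (hnn i) (hint i)] using this
    intro k
    have e : ∀ U : ℝ → ℝ, ∫ v in Set.Ioi 0, Real.exp (-(k * v)) * (Real.exp (-v) * U v)
        = ∫ v in Set.Ioi 0, Real.exp (-((k + 1 : ℝ) * v)) * U v := by
      intro U
      refine setIntegral_congr_fun measurableSet_Ioi fun v _ => ?_
      rw [← mul_assoc, ← Real.exp_add]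
      ring_nf
    simp only [hMint _ hnn₀ hint₀, fun i => hMint _ (hnn i) (hint i), e]
    exact h (k + 1) (by positivity)
  have hbi : ∀ (f : ℝ → ℝ), Continuous f → ∀ U : ℝ → ℝ,
      IntegrableOn (fun v => Real.exp (-v) * U v) (Set.Ioi 0) →
      IntegrableOn (fun v => f (Real.exp (-v)) * (Real.exp (-v) * U v)) (Set.Ioi 0) := by
    intro f hf U hU
    obtain ⟨C, hC⟩ := isCompact_Icc.exists_bound_of_continuousOn (s := Set.Icc (0 : ℝ) 1)
      hf.continuousOn
    refine Integrable.bdd_mul (c := C) hU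
      (Continuous.aestronglyMeasurable (hf.comp (by fun_prop))) ?_
    refine (ae_restrict_iff' measurableSet_Ioi).2 (ae_of_all _ fun v hv => ?_)
    exact hC _ ⟨(Real.exp_pos _).le, by simpa using (le_of_lt hv)⟩
  have hone : IntegrableOn (fun v : ℝ => Real.exp (-v) * 1) (Set.Ioi 0) := by
    simpa using integrableOn_exp_mul_Ioi (a := -1) (by norm_num) 0
  -- comparison of two weights against a bump supported in `[b, c]`
  have hcmp : ∀ (f : ℝ → ℝ), Continuous f → (∀ u, 0 ≤ f u) → ∀ b c : ℝ, 0 < b →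
      (∀ v, v ∉ Set.Icc b c → f (Real.exp (-v)) = 0) → ∀ U V : ℝ → ℝ,
      IntegrableOn (fun v => Real.exp (-v) * U v) (Set.Ioi 0) →
      IntegrableOn (fun v => Real.exp (-v) * V v) (Set.Ioi 0) →
      (∀ v ∈ Set.Icc b c, U v ≤ V v) →
      ∫ v in Set.Ioi 0, f (Real.exp (-v)) * (Real.exp (-v) * U v)
        ≤ ∫ v in Set.Ioi 0, f (Real.exp (-v)) * (Real.exp (-v) * V v) := by
    intro f hf hf0 b c hb hsupp U V hU hV hUV
    refine integral_mono (hbi f hf U hU) (hbi f hf V hV) fun v => ?_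
    by_cases hv : v ∈ Set.Icc b c
    · have := hUV v hv
      have := hf0 (Real.exp (-v))
      dsimp only
      gcongr
    · simp [hsupp v hv]
  have hconst : ∀ (f : ℝ → ℝ) (A : ℝ),
      ∫ v in Set.Ioi 0, f (Real.exp (-v)) * (Real.exp (-v) * A)
        = A * ∫ v in Set.Ioi 0, f (Real.exp (-v)) * Real.exp (-v) := by
    intro f A
    rw [← integral_const_mul]
    congr 1
    ext v
    ring
  have hAint : ∀ A : ℝ, IntegrableOn (fun v : ℝ => Real.exp (-v) * A) (Set.Ioi 0) := by
    intro A
    simpa [IntegrableOn] using hone.mul_const A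
  rw [Metric.continuousAt_iff] at hcont
  refine tendsto_order.2 ⟨fun y hy => ?_, fun y hy => ?_⟩
  -- lower bound: a bump to the right of `a`, where `T i ≤ T i a`
  · obtain ⟨δ, hδ, hδ'⟩ := hcont ((T₀ a - y) / 2) (by linarith)
    obtain ⟨f, hf, hf0, hsupp, hW⟩ := exists_bump_comp_exp_neg ha
      (show a < a + δ / 2 by linarith)
    have h1 := hcmp f hf hf0 _ _ ha hsupp (fun _ => (T₀ a + y) / 2) T₀ (hAint _) hint₀ ?_
    · rw [hconst] at h1
      have h2 : y * ∫ v in Set.Ioi 0, f (Real.exp (-v)) * Real.exp (-v)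
          < ∫ v in Set.Ioi 0, f (Real.exp (-v)) * (Real.exp (-v) * T₀ v) := by
        refine lt_of_lt_of_le ?_ h1
        gcongr
        linarith
      filter_upwards [(hlim f hf).eventually_const_lt h2] with i hi
      have h3 := hcmp f hf hf0 _ _ ha hsupp (T i) (fun _ => T i a) (hint i) (hAint _)
        fun v hv => hT i (Set.mem_Ioi.2 ha) (Set.mem_Ioi.2 (ha.trans_le hv.1)) hv.1
      rw [hconst] at h3
      exact lt_of_mul_lt_mul_right (hi.trans_le h3) hW.le
    · intro v hv
      have := hδ' (x := v) (by
        rw [Real.dist_eq, abs_of_nonneg (by linarith [hv.1])]; linarith [hv.2])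
      rw [Real.dist_eq, abs_lt] at this
      linarith [this.1]
  -- upper bound: a bump to the left of `a`, where `T i ≥ T i a`
  · obtain ⟨δ, hδ, hδ'⟩ := hcont ((y - T₀ a) / 2) (by linarith)
    have hb : 0 < max (a / 2) (a - δ / 2) := lt_max_of_lt_left (by linarith)
    have hba : max (a / 2) (a - δ / 2) < a := max_lt (by linarith) (by linarith)
    obtain ⟨f, hf, hf0, hsupp, hW⟩ := exists_bump_comp_exp_neg hb hba
    have h1 := hcmp f hf hf0 _ _ hb hsupp T₀ (fun _ => (T₀ a + y) / 2) hint₀ (hAint _) ?_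
    · rw [hconst] at h1
      have h2 : ∫ v in Set.Ioi 0, f (Real.exp (-v)) * (Real.exp (-v) * T₀ v)
          < y * ∫ v in Set.Ioi 0, f (Real.exp (-v)) * Real.exp (-v) := by
        refine lt_of_le_of_lt h1 ?_
        gcongr
        linarith
      filter_upwards [(hlim f hf).eventually_lt_const h2] with i hi
      have h3 := hcmp f hf hf0 _ _ hb hsupp (fun _ => T i a) (T i) (hAint _) (hint i)
        fun v hv => hT i (Set.mem_Ioi.2 (hb.trans_le hv.1)) (Set.mem_Ioi.2 ha) hv.2
      rw [hconst] at h3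
      exact lt_of_mul_lt_mul_right (h3.trans_lt hi) hW.le
    · intro v hv
      have := (le_max_right _ _).trans hv.1
      have := hδ' (x := v) (by
        rw [Real.dist_eq, abs_of_nonpos (by linarith [hv.2])]; linarith)
      rw [Real.dist_eq, abs_lt] at this
      linarith [this.2]

/-- Fubini's theorem in the form used for layer-cake formulas: `R` relates the random variable to
the level, as in `{z | z.2 < y z.1}`. -/
theorem integral_setIntegral_Ioi_swap {μ : Measure ℝ} [IsProbabilityMeasure μ] {k : ℝ → ℝ}
    (hk : IntegrableOn k (Set.Ioi 0)) {R : Set (ℝ × ℝ)} (hR : MeasurableSet R) :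
    ∫ x, (∫ s in Set.Ioi 0, R.indicator (fun z => k z.2) (x, s)) ∂μ
      = ∫ s in Set.Ioi 0, k s * μ.real {x | (x, s) ∈ R} := by
  rw [integral_integral_swap]
  · refine integral_congr_ae (ae_of_all _ fun s => ?_)
    have hms : MeasurableSet {x | (x, s) ∈ R} := (measurable_id.prodMk measurable_const) hR
    have : (fun x => R.indicator (fun z : ℝ × ℝ => k z.2) (x, s))
        = {x | (x, s) ∈ R}.indicator fun _ => k s := by
      ext x
      simp [Set.indicator]
    simp only [this]
    rw [integral_indicator_const _ hms, smul_eq_mul, mul_comm]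
  · have h1 : Integrable (fun z : ℝ × ℝ => k z.2) (μ.prod (volume.restrict (Set.Ioi 0))) :=
      hk.comp_snd μ
    exact h1.indicator hR

/-! ### The profile of the Cauchy kernel -/

/-- The Cauchy kernel of dimension `d` at time `s` and distance `δ`, without its normalising
constant. The dimension is a real number, so that no casts are needed. -/
noncomputable def poissonProfile (d δ s : ℝ) : ℝ := s / (s ^ 2 + δ ^ 2) ^ ((d + 1) / 2)

/-- The derivative of `poissonProfile d δ` in the time variable. -/
noncomputable def poissonProfileDeriv (d δ s : ℝ) : ℝ :=
  (δ ^ 2 - d * s ^ 2) / (s ^ 2 + δ ^ 2) ^ ((d + 3) / 2)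

theorem hasDerivAt_poissonProfile (d : ℝ) {δ : ℝ} (hδ : 0 < δ) (s : ℝ) :
    HasDerivAt (poissonProfile d δ) (poissonProfileDeriv d δ s) s := by
  have hp : 0 < s ^ 2 + δ ^ 2 := by positivity
  have h1 : HasDerivAt (fun s : ℝ => s ^ 2 + δ ^ 2) (2 * s) s := by
    simpa using ((hasDerivAt_id s).pow 2).add_const (δ ^ 2)
  have h2 := (hasDerivAt_id s).div (h1.rpow_const (p := (d + 1) / 2) (Or.inl hp.ne'))
    (Real.rpow_pos_of_pos hp _).ne'
  refine h2.congr_deriv ?_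
  unfold poissonProfileDeriv
  have e1 : (s ^ 2 + δ ^ 2) ^ ((d + 1) / 2 - 1)
      = (s ^ 2 + δ ^ 2) ^ ((d + 1) / 2) / (s ^ 2 + δ ^ 2) := by
    rw [Real.rpow_sub hp, Real.rpow_one]
  have e2 : (s ^ 2 + δ ^ 2) ^ ((d + 3) / 2)
      = (s ^ 2 + δ ^ 2) ^ ((d + 1) / 2) * (s ^ 2 + δ ^ 2) := by
    rw [← Real.rpow_add_one hp.ne']
    ring_nf
  have hq := Real.rpow_pos_of_pos hp ((d + 1) / 2)
  rw [e1, e2]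
  simp only [id]
  generalize (s ^ 2 + δ ^ 2) ^ ((d + 1) / 2) = q at hq ⊢
  field_simp
  ring

theorem measurable_poissonProfile (d δ : ℝ) : Measurable (poissonProfile d δ) := by
  unfold poissonProfile
  fun_prop

theorem continuous_poissonProfileDeriv (d : ℝ) {δ : ℝ} (hδ : 0 < δ) :
    Continuous (poissonProfileDeriv d δ) := by
  unfold poissonProfileDeriv
  have hp : ∀ s : ℝ, 0 < s ^ 2 + δ ^ 2 := fun s => by positivity
  exact (by fun_prop : Continuous fun s : ℝ => δ ^ 2 - d * s ^ 2).div
    (Continuous.rpow_const (by fun_prop) fun s => Or.inl (hp s).ne')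
    fun s => (Real.rpow_pos_of_pos (hp s) _).ne'

theorem poissonProfile_nonneg (d δ : ℝ) {s : ℝ} (hs : 0 ≤ s) : 0 ≤ poissonProfile d δ s := by
  unfold poissonProfile
  positivity

theorem rpow_neg_eq_one_div_sq_rpow {s : ℝ} (hs : 0 < s) (d : ℝ) :
    1 / (s ^ 2) ^ ((d + 1) / 2) = s ^ (-(d + 1)) := by
  rw [← Real.rpow_natCast, ← Real.rpow_mul hs.le, Real.rpow_neg hs.le, one_div]
  congr 2
  push_cast
  ring

theorem poissonProfile_zero (d : ℝ) {s : ℝ} (hs : 0 < s) : poissonProfile d 0 s = s ^ (-d) := by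
  have h := rpow_neg_eq_one_div_sq_rpow hs d
  unfold poissonProfile
  rw [show s ^ 2 + (0 : ℝ) ^ 2 = s ^ 2 by ring, div_eq_mul_one_div, h]
  nth_rewrite 1 [← Real.rpow_one s]
  rw [← Real.rpow_add hs]
  ring_nf

theorem poissonProfile_le {d : ℝ} (hd : 1 ≤ d) (δ : ℝ) {s : ℝ} (hs : 0 < s) :
    poissonProfile d δ s ≤ s ^ (-d) := by
  rw [← poissonProfile_zero d hs]
  unfold poissonProfile
  have h0 : 0 < s ^ 2 + (0 : ℝ) ^ 2 := by positivity
  have hle : s ^ 2 + (0 : ℝ) ^ 2 ≤ s ^ 2 + δ ^ 2 := by nlinarith [sq_nonneg δ]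
  exact div_le_div_of_nonneg_left hs.le (Real.rpow_pos_of_pos h0 _)
    (Real.rpow_le_rpow h0.le hle (by linarith))

/-- The profile is homogeneous of degree `-d`. -/
theorem poissonProfile_mul (d : ℝ) {a : ℝ} (ha : 0 < a) (δ s : ℝ) :
    poissonProfile d (a * δ) (a * s) = a ^ (-d) * poissonProfile d δ s := by
  unfold poissonProfile
  rw [show (a * s) ^ 2 + (a * δ) ^ 2 = a ^ 2 * (s ^ 2 + δ ^ 2) by ring,
    Real.mul_rpow (by positivity) (by positivity)]
  have h := rpow_neg_eq_one_div_sq_rpow ha d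
  have h2 : a ^ (-d) = a * (1 / (a ^ 2) ^ ((d + 1) / 2)) := by
    rw [h]
    nth_rewrite 2 [← Real.rpow_one a]
    rw [← Real.rpow_add ha]
    ring_nf
  rw [h2]
  field_simp

theorem tendsto_poissonProfile_atTop {d : ℝ} (hd : 1 ≤ d) (δ : ℝ) :
    Tendsto (poissonProfile d δ) atTop (𝓝 0) := by
  refine tendsto_of_tendsto_of_tendsto_of_le_of_le' tendsto_const_nhds
    (tendsto_rpow_neg_atTop (by linarith : 0 < d)) ?_ ?_
  · filter_upwards [eventually_ge_atTop 0] with s hs using poissonProfile_nonneg d δ hs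
  · filter_upwards [eventually_gt_atTop 0] with s hs using poissonProfile_le hd δ hs

theorem abs_poissonProfileDeriv_le {d : ℝ} (hd : 1 ≤ d) {δ : ℝ} (hδ : 0 < δ) (s : ℝ) :
    |poissonProfileDeriv d δ s| ≤ d * (1 / (s ^ 2 + δ ^ 2) ^ ((d + 1) / 2)) := by
  have hp : 0 < s ^ 2 + δ ^ 2 := by positivity
  have e2 : (s ^ 2 + δ ^ 2) ^ ((d + 3) / 2)
      = (s ^ 2 + δ ^ 2) ^ ((d + 1) / 2) * (s ^ 2 + δ ^ 2) := by
    rw [← Real.rpow_add_one hp.ne']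
    ring_nf
  have hq := Real.rpow_pos_of_pos hp ((d + 1) / 2)
  unfold poissonProfileDeriv
  rw [e2, abs_div,
    abs_of_pos (by positivity : 0 < (s ^ 2 + δ ^ 2) ^ ((d + 1) / 2) * (s ^ 2 + δ ^ 2))]
  have h3 : |δ ^ 2 - d * s ^ 2| ≤ d * (s ^ 2 + δ ^ 2) := by
    rw [abs_le]
    constructor <;> nlinarith [sq_nonneg δ, sq_nonneg s]
  rw [div_le_iff₀ (by positivity)]
  calc _ ≤ d * (s ^ 2 + δ ^ 2) := h3
    _ = _ := by field_simp

theorem abs_poissonProfileDeriv_le_rpow {d : ℝ} (hd : 1 ≤ d) {δ : ℝ} (hδ : 0 < δ) {s : ℝ}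
    (hs : 0 < s) : |poissonProfileDeriv d δ s| ≤ d * s ^ (-(d + 1)) := by
  refine (abs_poissonProfileDeriv_le hd hδ s).trans ?_
  rw [← rpow_neg_eq_one_div_sq_rpow hs]
  gcongr
  nlinarith [sq_nonneg δ]

theorem mul_abs_poissonProfileDeriv_le {d : ℝ} (hd : 1 ≤ d) {δ : ℝ} (hδ : 0 < δ) {s : ℝ}
    (hs : 0 ≤ s) : s * |poissonProfileDeriv d δ s| ≤ d * poissonProfile d δ s := by
  have := mul_le_mul_of_nonneg_left (abs_poissonProfileDeriv_le hd hδ s) hs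
  refine this.trans (le_of_eq ?_)
  unfold poissonProfile
  ring

theorem integrableOn_Ioi_rpow_neg_add_one {d η : ℝ} (hd : 1 ≤ d) (hη : 0 < η) :
    IntegrableOn (fun s : ℝ => s ^ (-(d + 1))) (Set.Ioi η) :=
  integrableOn_Ioi_rpow_of_lt (by linarith) hη

theorem integrableOn_poissonProfileDeriv {d : ℝ} (hd : 1 ≤ d) {δ : ℝ} (hδ : 0 < δ) :
    IntegrableOn (poissonProfileDeriv d δ) (Set.Ioi 0) := by
  have hc := continuous_poissonProfileDeriv d hδ
  rw [← Set.Ioc_union_Ioi_eq_Ioi zero_le_one]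
  refine IntegrableOn.union ?_ ?_
  · exact (hc.integrableOn_Icc (a := 0) (b := 1)).mono_set Set.Ioc_subset_Icc_self
  · refine Integrable.mono' ((integrableOn_Ioi_rpow_neg_add_one hd one_pos).const_mul d)
      hc.aestronglyMeasurable ?_
    refine (ae_restrict_iff' measurableSet_Ioi).2 (ae_of_all _ fun s hs => ?_)
    exact abs_poissonProfileDeriv_le_rpow hd hδ (one_pos.trans hs)

/-- Layer-cake formula for the profile, which vanishes at `0`, in terms of upper tails. -/
theorem integral_poissonProfile_eq {μ : Measure ℝ} [IsProbabilityMeasure μ] {d : ℝ} (hd : 1 ≤ d)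
    {δ : ℝ} (hδ : 0 < δ) {y : ℝ → ℝ} (hy : Measurable y) (hpos : ∀ᵐ x ∂μ, 0 < y x) :
    ∫ x, poissonProfile d δ (y x) ∂μ
      = ∫ s in Set.Ioi 0, poissonProfileDeriv d δ s * μ.real {x | s < y x} := by
  have hR : MeasurableSet {z : ℝ × ℝ | z.2 < y z.1} := measurableSet_lt (by fun_prop) (by fun_prop)
  refine Eq.trans ?_ (integral_setIntegral_Ioi_swap (integrableOn_poissonProfileDeriv hd hδ) hR)
  refine integral_congr_ae ?_
  filter_upwards [hpos] with x hx
  have e : (fun s => {z : ℝ × ℝ | z.2 < y z.1}.indicator (fun z => poissonProfileDeriv d δ z.2)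
      (x, s)) = (Set.Iio (y x)).indicator (poissonProfileDeriv d δ) := by
    ext s
    simp [Set.indicator]
  rw [e, setIntegral_indicator measurableSet_Iio, Set.Ioi_inter_Iio, ← integral_Ioc_eq_integral_Ioo,
    ← intervalIntegral.integral_of_le hx.le,
    intervalIntegral.integral_eq_sub_of_hasDerivAt (fun s _ => hasDerivAt_poissonProfile d hδ s)
      ((continuous_poissonProfileDeriv d hδ).intervalIntegrable _ _)]
  simp [poissonProfile]

/-- Layer-cake formula for the profile, which vanishes at infinity, in terms of the distribution
function. -/
theorem integral_poissonProfile_eq_neg {μ : Measure ℝ} [IsProbabilityMeasure μ] {d : ℝ}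
    (hd : 1 ≤ d) {δ : ℝ} (hδ : 0 < δ) {y : ℝ → ℝ} (hy : Measurable y)
    (hpos : ∀ᵐ x ∂μ, 0 < y x) :
    ∫ x, poissonProfile d δ (y x) ∂μ
      = -∫ s in Set.Ioi 0, poissonProfileDeriv d δ s * μ.real {x | y x < s} := by
  have hR : MeasurableSet {z : ℝ × ℝ | y z.1 < z.2} := measurableSet_lt (by fun_prop) (by fun_prop)
  have hi := integrableOn_poissonProfileDeriv hd hδ
  refine Eq.trans ?_ (congrArg Neg.neg (integral_setIntegral_Ioi_swap hi hR))
  rw [← integral_neg]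
  refine integral_congr_ae ?_
  filter_upwards [hpos] with x hx
  have e : (fun s => {z : ℝ × ℝ | y z.1 < z.2}.indicator (fun z => poissonProfileDeriv d δ z.2)
      (x, s)) = (Set.Ioi (y x)).indicator (poissonProfileDeriv d δ) := by
    ext s
    simp [Set.indicator]
  rw [e, setIntegral_indicator measurableSet_Ioi, Set.Ioi_inter_Ioi, max_eq_right hx.le,
    integral_Ioi_of_hasDerivAt_of_tendsto' (fun s _ => hasDerivAt_poissonProfile d hδ s)
      (hi.mono_set (Set.Ioi_subset_Ioi hx.le)) (tendsto_poissonProfile_atTop hd δ)]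
  simp

/-! ### One-sided stable laws: negative moments and tail -/

/-- `μ` is the one-sided `β`-stable law: it is carried by `(0, ∞)` and its Laplace transform is
`exp (-r ^ β)`. -/
structure IsStableLaw (β : ℝ) (μ : Measure ℝ) : Prop where
  pos : ∀ᵐ x ∂μ, 0 < x
  laplace : ∀ r : ℝ, 0 < r → ∫ x, Real.exp (-r * x) ∂μ = Real.exp (-r ^ β)

namespace IsStableLaw

variable {β : ℝ} {μ : Measure ℝ} [IsProbabilityMeasure μ]

theorem integrable_exp (h : IsStableLaw β μ) {r : ℝ} (hr : 0 < r) :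
    Integrable (fun x => Real.exp (-r * x)) μ := by
  refine Integrable.of_bound (C := 1) (by fun_prop) ?_
  filter_upwards [h.pos] with x hx
  rw [Real.norm_of_nonneg (Real.exp_pos _).le]
  simpa using mul_nonneg hr.le hx.le

/-- The negative moments, obtained from `Γ(a) x ^ (-a) = ∫ r ^ (a - 1) exp (-r x) dr` and Fubini. -/
theorem integrable_rpow_neg_and_integral (h : IsStableLaw β μ) (hβ : 0 < β) {a : ℝ} (ha : 0 < a) :
    Integrable (fun x => x ^ (-a)) μ ∧
      ∫ x, x ^ (-a) ∂μ = Real.Gamma (a / β) / (β * Real.Gamma a) := by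
  have hG := Real.Gamma_pos_of_pos ha
  have hgamma : ∀ x : ℝ, 0 < x →
      ∫ r in Set.Ioi 0, r ^ (a - 1) * Real.exp (-r * x) = Real.Gamma a * x ^ (-a) := by
    intro x hx
    have := Real.integral_rpow_mul_exp_neg_mul_Ioi ha hx
    rw [one_div, Real.inv_rpow hx.le, ← Real.rpow_neg hx.le] at this
    rw [mul_comm, ← this]
    congr 1
    ext r
    ring_nf
  have hmeas : AEStronglyMeasurable (fun z : ℝ × ℝ => z.2 ^ (a - 1) * Real.exp (-z.2 * z.1))
      (μ.prod (volume.restrict (Set.Ioi 0))) := by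
    refine Measurable.aestronglyMeasurable ?_
    fun_prop
  have hprod : Integrable (fun z : ℝ × ℝ => z.2 ^ (a - 1) * Real.exp (-z.2 * z.1))
      (μ.prod (volume.restrict (Set.Ioi 0))) := by
    rw [integrable_prod_iff' hmeas]
    constructor
    · refine (ae_restrict_iff' measurableSet_Ioi).2 (ae_of_all _ fun r hr => ?_)
      exact (h.integrable_exp hr).const_mul (r ^ (a - 1))
    · refine (integrableOn_rpow_mul_exp_neg_rpow (s := a - 1) (by linarith) hβ).congr_fun
        (fun r hr => ?_) measurableSet_Ioi
      have hr' : (0 : ℝ) < r := hr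
      have : ∀ x : ℝ, ‖r ^ (a - 1) * Real.exp (-r * x)‖ = r ^ (a - 1) * Real.exp (-r * x) :=
        fun x => Real.norm_of_nonneg (by positivity)
      simp only [this]
      rw [integral_const_mul, h.laplace r hr]
  have hval : ∫ x, (∫ r in Set.Ioi 0, r ^ (a - 1) * Real.exp (-r * x)) ∂μ
      = 1 / β * Real.Gamma (a / β) := by
    rw [integral_integral_swap hprod]
    have := integral_rpow_mul_exp_neg_rpow (q := a - 1) hβ (by linarith)
    rw [sub_add_cancel] at this
    rw [← this]
    refine setIntegral_congr_fun measurableSet_Ioi fun r hr => ?_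
    rw [integral_const_mul, h.laplace r hr]
  have hae : (fun x => ∫ r in Set.Ioi 0, r ^ (a - 1) * Real.exp (-r * x))
      =ᵐ[μ] fun x => Real.Gamma a * x ^ (-a) := by
    filter_upwards [h.pos] with x hx using hgamma x hx
  constructor
  · have := (hprod.integral_prod_left.congr hae).const_mul (Real.Gamma a)⁻¹
    refine this.congr (ae_of_all _ fun x => ?_)
    simp only
    field_simp
  · rw [integral_congr_ae hae, integral_const_mul] at hval
    field_simp
    field_simp at hval
    linarith

/-- An upper bound of the order of the tail asymptotics, valid at all levels; it provides the
dominating functions. -/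
theorem tail_le (h : IsStableLaw β μ) {u : ℝ} (hu : 0 < u) :
    u ^ β * μ.real {x | u < x} ≤ 1 / (1 - Real.exp (-1)) := by
  have he : 0 < 1 - Real.exp (-1) := by
    have : Real.exp (-1) < 1 := by simp
    linarith
  have hu' : 0 < u⁻¹ := inv_pos.2 hu
  -- Markov's inequality for `1 - exp (-x / u)`
  have h1 : (1 - Real.exp (-1)) * μ.real {x | u < x} ≤ ∫ x, (1 - Real.exp (-u⁻¹ * x)) ∂μ := by
    have hi : Integrable (fun x => 1 - Real.exp (-u⁻¹ * x)) μ :=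
      (integrable_const _).sub (h.integrable_exp hu')
    refine le_trans ?_ (mul_meas_ge_le_integral_of_nonneg ?_ hi (1 - Real.exp (-1)))
    · refine mul_le_mul_of_nonneg_left (measureReal_mono fun x hx => ?_) he.le
      have : 1 ≤ u⁻¹ * x := by
        rw [inv_mul_eq_div, one_le_div hu]
        exact le_of_lt hx
      simp only [Set.mem_ofPred_eq, sub_le_sub_iff_left, Real.exp_le_exp]
      linarith
    · filter_upwards [h.pos] with x hx
      simp only [Pi.zero_apply, sub_nonneg, Real.exp_le_one_iff]
      have := mul_pos hu' hx
      linarith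
  rw [integral_sub (integrable_const _) (h.integrable_exp hu'), h.laplace _ hu'] at h1
  simp only [integral_const, probReal_univ, smul_eq_mul, mul_one] at h1
  have h2 : 1 - Real.exp (-u⁻¹ ^ β) ≤ u⁻¹ ^ β := by
    have := Real.add_one_le_exp (-u⁻¹ ^ β)
    linarith
  rw [Real.inv_rpow hu.le] at h1 h2
  have hub := Real.rpow_pos_of_pos hu β
  rw [le_div_iff₀ he]
  calc _ = u ^ β * ((1 - Real.exp (-1)) * μ.real {x | u < x}) := by ring
    _ ≤ u ^ β * (u ^ β)⁻¹ := by gcongr; exact h1.trans h2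
    _ = 1 := mul_inv_cancel₀ hub.ne'

theorem integral_exp_mul_tail (h : IsStableLaw β μ) {c r : ℝ} (hc : 0 < c) (hr : 0 < r) :
    ∫ v in Set.Ioi 0, Real.exp (-(r * v)) * μ.real {x | c * v < x}
      = (1 - Real.exp (-(r / c) ^ β)) / r := by
  have hR : MeasurableSet {z : ℝ × ℝ | c * z.2 < z.1} :=
    measurableSet_lt (by fun_prop) (by fun_prop)
  have hk : IntegrableOn (fun v : ℝ => Real.exp (-(r * v))) (Set.Ioi 0) := by
    simpa using integrableOn_exp_mul_Ioi (a := -r) (by linarith) 0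
  have hrc : 0 < r / c := div_pos hr hc
  refine (integral_setIntegral_Ioi_swap hk hR).symm.trans ?_
  rw [← h.laplace _ hrc]
  have h1 : ∫ x, (1 - Real.exp (-(r / c) * x)) / r ∂μ
      = (1 - ∫ x, Real.exp (-(r / c) * x) ∂μ) / r := by
    rw [integral_div, integral_sub (integrable_const _) (h.integrable_exp hrc)]
    simp
  rw [← h1]
  refine integral_congr_ae ?_
  filter_upwards [h.pos] with x hx
  have e : (fun s => {z : ℝ × ℝ | c * z.2 < z.1}.indicator (fun z => Real.exp (-(r * z.2)))
      (x, s)) = (Set.Iio (x / c)).indicator fun s => Real.exp (-(r * s)) := by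
    ext s
    simp [Set.indicator, lt_div_iff₀ hc, mul_comm]
  have hd : ∀ s : ℝ, HasDerivAt (fun s => -Real.exp (-(r * s)) / r) (Real.exp (-(r * s))) s := by
    intro s
    have := ((((hasDerivAt_id s).const_mul r).neg).exp.neg).div_const r
    refine this.congr_deriv ?_
    simp only [id, Pi.neg_apply]
    field_simp
  rw [e, setIntegral_indicator measurableSet_Iio, Set.Ioi_inter_Iio, ← integral_Ioc_eq_integral_Ioo,
    ← intervalIntegral.integral_of_le (div_pos hx hc).le,
    intervalIntegral.integral_eq_sub_of_hasDerivAt (fun s _ => hd s)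
      (Continuous.intervalIntegrable (by fun_prop) _ _)]
  rw [show -(r / c) * x = -(r * (x / c)) by ring]
  simp
  ring

/-- The tail of the one-sided stable law, from the Tauberian theorem: the Laplace transform of the
rescaled tail converges to `r ^ (β - 1)`, which is that of `v ^ (-β) / Γ(1 - β)`. -/
theorem tendsto_tail (h : IsStableLaw β μ) (hβ0 : 0 < β) (hβ1 : β < 1) :
    Tendsto (fun u : ℝ => u ^ β * μ.real {x | u < x}) atTop (𝓝 (1 / Real.Gamma (1 - β))) := by
  have hG : 0 < Real.Gamma (1 - β) := Real.Gamma_pos_of_pos (by linarith)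
  have hexp : IntegrableOn (fun v : ℝ => Real.exp (-v)) (Set.Ioi 0) := by
    simpa using integrableOn_exp_mul_Ioi (a := -1) (by norm_num) 0
  have hm : ∀ u : ℝ, 0 < max u 1 := fun u => lt_max_of_lt_right one_pos
  have hanti : ∀ u : ℝ, Antitone fun v : ℝ => μ.real {x | max u 1 * v < x} := by
    intro u v w hvw
    refine measureReal_mono fun x hx => ?_
    have := mul_le_mul_of_nonneg_left hvw (hm u).le
    exact lt_of_le_of_lt this hx
  -- the Tauberian theorem asks for antitone functions for every index, so the scale is kept
  -- positive by replacing `u` with `max u 1`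
  have key := tendsto_of_antitoneOn_of_laplace (l := atTop)
    (T := fun u v => (max u 1) ^ β * μ.real {x | max u 1 * v < x})
    (T₀ := fun v => 1 / Real.Gamma (1 - β) * v ^ (-β)) ?_ ?_ ?_ ?_ ?_ ?_ one_pos ?_
  · simp only [Real.one_rpow, mul_one] at key
    refine key.congr' ?_
    filter_upwards [eventually_ge_atTop 1] with u hu
    rw [max_eq_left hu]
  · intro u v _ w _ hvw
    have := hanti u hvw
    have := hm u
    dsimp only at *
    gcongr
  · intro u v _
    have := hm u
    positivity
  · intro v hv
    positivity
  · intro u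
    refine Integrable.mul_bdd (c := (max u 1) ^ β) hexp ?_ (ae_of_all _ fun v => ?_)
    · exact ((hanti u).measurable.const_mul _).aestronglyMeasurable
    · have := hm u
      rw [Real.norm_of_nonneg (by positivity)]
      exact mul_le_of_le_one_right (by positivity) measureReal_le_one
  · have := (Real.GammaIntegral_convergent (s := 1 - β) (by linarith)).const_mul
      (1 / Real.Gamma (1 - β))
    refine IntegrableOn.congr_fun this (fun v _ => ?_) measurableSet_Ioi
    ring_nf
  · intro r hr
    have e0 : ∫ v in Set.Ioi 0, Real.exp (-(r * v)) * (1 / Real.Gamma (1 - β) * v ^ (-β))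
        = r ^ β / r := by
      have := Real.integral_rpow_mul_exp_neg_mul_Ioi (a := 1 - β) (by linarith) hr
      calc _ = ∫ v in Set.Ioi 0, 1 / Real.Gamma (1 - β)
              * (v ^ ((1 - β) - 1) * Real.exp (-(r * v))) := by
            congr 1
            ext v
            ring_nf
        _ = 1 / Real.Gamma (1 - β) * ((1 / r) ^ (1 - β) * Real.Gamma (1 - β)) := by
            rw [integral_const_mul, this]
        _ = (1 / r) ^ (1 - β) := by field_simp
        _ = r ^ β / r := by
            rw [one_div, Real.inv_rpow hr.le, ← Real.rpow_neg hr.le, neg_sub, Real.rpow_sub hr,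
              Real.rpow_one]
    rw [e0]
    have e1 : ∀ u : ℝ, ∫ v in Set.Ioi 0,
        Real.exp (-(r * v)) * ((max u 1) ^ β * μ.real {x | max u 1 * v < x})
          = (max u 1) ^ β * ((1 - Real.exp (-(r / max u 1) ^ β)) / r) := by
      intro u
      rw [← h.integral_exp_mul_tail (hm u) hr, ← integral_const_mul]
      congr 1
      ext v
      ring
    simp only [e1]
    have hslope : Tendsto (fun z : ℝ => z⁻¹ * (1 - Real.exp (-z))) (𝓝[≠] 0) (𝓝 1) := by
      have hd : HasDerivAt (fun z : ℝ => -Real.exp (-z)) 1 0 := by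
        have := ((hasDerivAt_neg (0 : ℝ)).exp).neg
        refine this.congr_deriv ?_
        simp
      have := hasDerivAt_iff_tendsto_slope_zero.1 hd
      refine this.congr fun z => ?_
      simp only [zero_add, neg_zero, Real.exp_zero, smul_eq_mul]
      ring
    have hz : Tendsto (fun u : ℝ => (r / u) ^ β) atTop (𝓝[≠] 0) := by
      refine tendsto_nhdsWithin_iff.2 ⟨?_, ?_⟩
      · have := (tendsto_const_nhds (x := r)).div_atTop tendsto_id (α := ℝ) (l := atTop)
        have h2 := this.rpow_const (p := β) (Or.inr hβ0.le)
        rwa [Real.zero_rpow hβ0.ne'] at h2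
      · filter_upwards [eventually_gt_atTop 0] with u hu
        exact (Real.rpow_pos_of_pos (div_pos hr hu) _).ne'
    have h3 := (hslope.comp hz).const_mul (r ^ β / r)
    rw [mul_one] at h3
    refine h3.congr' ?_
    filter_upwards [eventually_ge_atTop 1] with u hu
    have hu0 : 0 < u := by linarith
    have hub := Real.rpow_pos_of_pos hu0 β
    have hrb := Real.rpow_pos_of_pos hr β
    simp only [Function.comp, max_eq_left hu]
    generalize Real.exp (-(r / u) ^ β) = E
    rw [Real.div_rpow hr.le hu0.le]
    field_simp
  · exact (continuousAt_const.mul (Real.continuousAt_rpow_const _ _ (Or.inl one_ne_zero)))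

end IsStableLaw

/-! ### Integrals of the profile -/

/-- A beta integral on the half-line, computed by writing `(v ^ 2 + 1) ^ (-a)` as a Gamma
integral. -/
theorem integrableOn_and_integral_rpow_neg_mul_sq_add_one_rpow {a β : ℝ} (hβ1 : β < 1)
    (ha : (1 - β) / 2 < a) :
    IntegrableOn (fun v : ℝ => v ^ (-β) * (1 / (v ^ 2 + 1) ^ a)) (Set.Ioi 0) ∧
      ∫ v in Set.Ioi 0, v ^ (-β) * (1 / (v ^ 2 + 1) ^ a)
        = Real.Gamma ((1 - β) / 2) * Real.Gamma (a - (1 - β) / 2) / (2 * Real.Gamma a) := by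
  have ha0 : 0 < a := by linarith
  have hG := Real.Gamma_pos_of_pos ha0
  have hu : ∀ v : ℝ, ∫ u in Set.Ioi 0, v ^ (-β) * (u ^ (a - 1) * Real.exp (-((v ^ 2 + 1) * u)))
      = Real.Gamma a * (v ^ (-β) * (1 / (v ^ 2 + 1) ^ a)) := by
    intro v
    have hv : 0 < v ^ 2 + 1 := by positivity
    rw [integral_const_mul, Real.integral_rpow_mul_exp_neg_mul_Ioi ha0 hv,
      Real.div_rpow zero_le_one hv.le, Real.one_rpow]
    ring
  have hv : ∀ u : ℝ, 0 < u →
      IntegrableOn (fun v : ℝ => v ^ (-β) * (u ^ (a - 1) * Real.exp (-((v ^ 2 + 1) * u))))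
        (Set.Ioi 0) ∧
      ∫ v in Set.Ioi 0, v ^ (-β) * (u ^ (a - 1) * Real.exp (-((v ^ 2 + 1) * u)))
        = Real.Gamma ((1 - β) / 2) / 2
          * (Real.exp (-u) * u ^ (a - (1 - β) / 2 - 1)) := by
    intro u hu
    have e : ∀ v : ℝ, v ^ (-β) * (u ^ (a - 1) * Real.exp (-((v ^ 2 + 1) * u)))
        = u ^ (a - 1) * Real.exp (-u) * (v ^ (-β) * Real.exp (-u * v ^ (2 : ℝ))) := by
      intro v
      rw [show -((v ^ 2 + 1) * u) = -u + -u * v ^ (2 : ℝ) by rw [Real.rpow_two]; ring,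
        Real.exp_add]
      ring
    simp only [e]
    constructor
    · exact (integrableOn_rpow_mul_exp_neg_mul_rpow (by linarith) two_pos hu).const_mul _
    · rw [integral_const_mul,
        integral_rpow_mul_exp_neg_mul_rpow two_pos (by linarith : -1 < -β) hu]
      rw [show a - (1 - β) / 2 - 1 = (a - 1) + -(-β + 1) / 2 by ring, Real.rpow_add hu]
      ring_nf
  have hmeas : AEStronglyMeasurable
      (fun z : ℝ × ℝ => z.1 ^ (-β) * (z.2 ^ (a - 1) * Real.exp (-((z.1 ^ 2 + 1) * z.2))))
      ((volume.restrict (Set.Ioi 0)).prod (volume.restrict (Set.Ioi 0))) := by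
    refine Measurable.aestronglyMeasurable ?_
    fun_prop
  have hΓ : IntegrableOn (fun u : ℝ => Real.Gamma ((1 - β) / 2) / 2
      * (Real.exp (-u) * u ^ (a - (1 - β) / 2 - 1))) (Set.Ioi 0) :=
    (Real.GammaIntegral_convergent (by linarith)).const_mul _
  have hprod : Integrable
      (fun z : ℝ × ℝ => z.1 ^ (-β) * (z.2 ^ (a - 1) * Real.exp (-((z.1 ^ 2 + 1) * z.2))))
      ((volume.restrict (Set.Ioi 0)).prod (volume.restrict (Set.Ioi 0))) := by
    rw [integrable_prod_iff' hmeas]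
    constructor
    · exact (ae_restrict_iff' measurableSet_Ioi).2 (ae_of_all _ fun u hu => (hv u hu).1)
    · refine hΓ.congr_fun (fun u hu => ?_) measurableSet_Ioi
      have hu' : (0 : ℝ) < u := hu
      simp only
      rw [← (hv u hu').2]
      refine setIntegral_congr_fun measurableSet_Ioi fun v hv' => ?_
      have : (0 : ℝ) < v := hv'
      exact (Real.norm_of_nonneg (by positivity)).symm
  constructor
  · refine (hprod.integral_prod_left.const_mul (Real.Gamma a)⁻¹).congr (ae_of_all _ fun v => ?_)
    simp only
    rw [hu]
    field_simp
  · have h1 := integral_integral_swap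
      (f := fun v u : ℝ => v ^ (-β) * (u ^ (a - 1) * Real.exp (-((v ^ 2 + 1) * u)))) hprod
    simp only [hu] at h1
    rw [integral_const_mul, setIntegral_congr_fun measurableSet_Ioi fun u hu => (hv u hu).2,
      integral_const_mul, ← Real.Gamma_eq_integral (by linarith)] at h1
    rw [eq_div_iff (by positivity)]
    linarith

theorem poissonProfileDeriv_one (d v : ℝ) : poissonProfileDeriv d 1 v
    = (d + 1) * (1 / (v ^ 2 + 1) ^ ((d + 3) / 2)) - d * (1 / (v ^ 2 + 1) ^ ((d + 1) / 2)) := by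
  have hp : 0 < v ^ 2 + 1 := by positivity
  have e2 : (v ^ 2 + 1) ^ ((d + 3) / 2) = (v ^ 2 + 1) ^ ((d + 1) / 2) * (v ^ 2 + 1) := by
    rw [← Real.rpow_add_one hp.ne']
    ring_nf
  have hq := Real.rpow_pos_of_pos hp ((d + 1) / 2)
  unfold poissonProfileDeriv
  rw [one_pow, e2]
  field_simp
  ring

theorem integral_poissonProfileDeriv_mul_rpow {d β : ℝ} (hd : 1 ≤ d) (hβ0 : 0 < β)
    (hβ1 : β < 1) :
    ∫ v in Set.Ioi 0, poissonProfileDeriv d 1 v * v ^ (-β)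
      = β * Real.Gamma ((1 - β) / 2) * Real.Gamma ((d + β) / 2)
        / (2 * Real.Gamma ((d + 1) / 2)) := by
  obtain ⟨i1, e1⟩ := integrableOn_and_integral_rpow_neg_mul_sq_add_one_rpow (a := (d + 1) / 2)
    hβ1 (by linarith)
  obtain ⟨i2, e2⟩ := integrableOn_and_integral_rpow_neg_mul_sq_add_one_rpow (a := (d + 3) / 2)
    hβ1 (by linarith)
  have e : ∀ v : ℝ, poissonProfileDeriv d 1 v * v ^ (-β)
      = (d + 1) * (v ^ (-β) * (1 / (v ^ 2 + 1) ^ ((d + 3) / 2)))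
        - d * (v ^ (-β) * (1 / (v ^ 2 + 1) ^ ((d + 1) / 2))) := by
    intro v
    rw [poissonProfileDeriv_one]
    ring
  simp only [e]
  rw [integral_sub (i2.const_mul _) (i1.const_mul _), integral_const_mul, integral_const_mul,
    e1, e2, show (d + 3) / 2 = (d + 1) / 2 + 1 by ring,
    show (d + 1) / 2 + 1 - (1 - β) / 2 = (d + β) / 2 + 1 by ring,
    show (d + 1) / 2 - (1 - β) / 2 = (d + β) / 2 by ring,
    Real.Gamma_add_one (by linarith : (d + 1) / 2 ≠ 0) ,
    Real.Gamma_add_one (by linarith : (d + β) / 2 ≠ 0)]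
  have hG : 0 < Real.Gamma ((d + 1) / 2) := Real.Gamma_pos_of_pos (by linarith)
  have hd1 : d + 1 ≠ 0 := by linarith
  field_simp
  ring

theorem integral_Ioc_poissonProfile_one {δ : ℝ} (hδ : 0 < δ) :
    ∫ s in Set.Ioc (0 : ℝ) 1, poissonProfile 1 δ s
      = (Real.log (1 + δ ^ 2) - 2 * Real.log δ) / 2 := by
  have hp : ∀ s : ℝ, 0 < s ^ 2 + δ ^ 2 := fun s => by positivity
  have hd : ∀ s : ℝ, HasDerivAt (fun s => Real.log (s ^ 2 + δ ^ 2) / 2)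
      (poissonProfile 1 δ s) s := by
    intro s
    have h1 : HasDerivAt (fun s : ℝ => s ^ 2 + δ ^ 2) (2 * s) s := by
      simpa using ((hasDerivAt_id s).pow 2).add_const (δ ^ 2)
    refine ((h1.log (hp s).ne').div_const 2).congr_deriv ?_
    unfold poissonProfile
    norm_num
    ring
  have hc : Continuous (poissonProfile 1 δ) :=
    continuous_iff_continuousAt.2 fun s => (hasDerivAt_poissonProfile 1 hδ s).continuousAt
  rw [← intervalIntegral.integral_of_le zero_le_one,
    intervalIntegral.integral_eq_sub_of_hasDerivAt (fun s _ => hd s) (hc.intervalIntegrable _ _)]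
  rw [show (0 : ℝ) ^ 2 + δ ^ 2 = δ ^ 2 by ring, Real.log_pow]
  push_cast
  ring_nf

theorem integral_Ioc_poissonProfile_of_one_lt {d δ : ℝ} (hd : 1 < d) (hδ : 0 < δ) :
    ∫ s in Set.Ioc (0 : ℝ) 1, poissonProfile d δ s
      = (δ ^ (1 - d) - (1 + δ ^ 2) ^ ((1 - d) / 2)) / (d - 1) := by
  have hp : ∀ s : ℝ, 0 < s ^ 2 + δ ^ 2 := fun s => by positivity
  have hd1 : 1 - d ≠ 0 := by linarith
  have hder : ∀ s : ℝ, HasDerivAt (fun s => (s ^ 2 + δ ^ 2) ^ ((1 - d) / 2) / (1 - d))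
      (poissonProfile d δ s) s := by
    intro s
    have h1 : HasDerivAt (fun s : ℝ => s ^ 2 + δ ^ 2) (2 * s) s := by
      simpa using ((hasDerivAt_id s).pow 2).add_const (δ ^ 2)
    refine ((h1.rpow_const (p := (1 - d) / 2) (Or.inl (hp s).ne')).div_const (1 - d)).congr_deriv ?_
    unfold poissonProfile
    rw [show (1 - d) / 2 - 1 = -((d + 1) / 2) by ring, Real.rpow_neg (hp s).le]
    field_simp
  have hc : Continuous (poissonProfile d δ) :=
    continuous_iff_continuousAt.2 fun s => (hasDerivAt_poissonProfile d hδ s).continuousAt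
  rw [← intervalIntegral.integral_of_le zero_le_one,
    intervalIntegral.integral_eq_sub_of_hasDerivAt (fun s _ => hder s) (hc.intervalIntegrable _ _)]
  rw [show (0 : ℝ) ^ 2 + δ ^ 2 = δ ^ 2 by ring, ← Real.rpow_natCast δ 2, ← Real.rpow_mul hδ.le,
    show ((2 : ℕ) : ℝ) * ((1 - d) / 2) = 1 - d by push_cast; ring, one_pow]
  have : d - 1 ≠ 0 := by linarith
  rw [Real.rpow_natCast]
  field_simp
  ring

/-- If the distribution function of `y` is asymptotic to `κ s` at `0` and the integral of the
profile over `(0, 1]` diverges as `δ → 0`, then only the behaviour of `y` near `0` matters, and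
the expectation of the profile is asymptotic to `κ` times that integral. -/
theorem tendsto_integral_poissonProfile_div {μ : Measure ℝ} [IsProbabilityMeasure μ] {d : ℝ}
    (hd : 1 ≤ d) {y : ℝ → ℝ} (hy : Measurable y) (hpos : ∀ᵐ x ∂μ, 0 < y x) {κ : ℝ}
    (hκ : Tendsto (fun s => μ.real {x | y x < s} / s) (𝓝[>] 0) (𝓝 κ))
    (hI : Tendsto (fun δ => ∫ s in Set.Ioc (0 : ℝ) 1, poissonProfile d δ s) (𝓝[>] 0) atTop) :
    Tendsto (fun δ => (∫ x, poissonProfile d δ (y x) ∂μ)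
      / ∫ s in Set.Ioc (0 : ℝ) 1, poissonProfile d δ s) (𝓝[>] 0) (𝓝 κ) := by
  have hUp : IsProbabilityMeasure (volume.restrict (Set.Ioc (0 : ℝ) 1)) :=
    ⟨by simp⟩
  -- the distribution function of the uniform law on `(0, 1]`
  set G : ℝ → ℝ := fun s => (volume.restrict (Set.Ioc (0 : ℝ) 1)).real {x | x < s} with hG
  set F : ℝ → ℝ := fun s => μ.real {x | y x < s} with hF
  have hGs : ∀ s, 0 < s → s ≤ 1 → G s = s := by
    intro s hs hs1
    have : {x : ℝ | x < s} ∩ Set.Ioc 0 1 = Set.Ioo 0 s := by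
      ext x
      simp only [Set.mem_inter_iff, Set.mem_ofPred_eq, Set.mem_Ioc, Set.mem_Ioo]
      constructor
      · rintro ⟨h1, h2, -⟩
        exact ⟨h2, h1⟩
      · rintro ⟨h1, h2⟩
        exact ⟨h2, h1, by linarith⟩
    rw [hG]
    simp only
    rw [measureReal_restrict_apply (show MeasurableSet {x : ℝ | x < s} from measurableSet_Iio),
      this]
    simp [hs.le]
  have hFm : Measurable F := Monotone.measurable fun a b hab =>
    measureReal_mono fun x hx => lt_of_lt_of_le hx hab
  have hGm : Measurable G := Monotone.measurable fun a b hab =>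
    measureReal_mono fun x hx => lt_of_lt_of_le hx hab
  have hF1 : ∀ s, |F s| ≤ 1 := fun s => by
    rw [abs_of_nonneg measureReal_nonneg]; exact measureReal_le_one
  have hG1 : ∀ s, |G s| ≤ 1 := fun s => by
    rw [abs_of_nonneg measureReal_nonneg]; exact measureReal_le_one
  rw [Metric.tendsto_nhds]
  intro ε hε
  have hd0 : 0 < d := by linarith
  obtain ⟨η₀, hη₀, hη₀'⟩ : ∃ η₀ > 0, ∀ s, 0 < s → s < η₀ → |F s / s - κ| < ε / (2 * d) := by
    have := Metric.tendsto_nhdsWithin_nhds.1 hκ (ε / (2 * d)) (by positivity)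
    obtain ⟨η₀, h1, h2⟩ := this
    refine ⟨η₀, h1, fun s hs hs' => ?_⟩
    have := h2 (x := s) hs (by rw [Real.dist_eq, sub_zero, abs_of_pos hs]; exact hs')
    rwa [Real.dist_eq] at this
  -- below `η` the two distribution functions agree to relative order `ε`; above `η` the derivative
  -- of the profile is bounded by an integrable power independent of `δ`, which accounts for `M`
  set η := min (η₀ / 2) 1 with hη
  have hηpos : 0 < η := lt_min (by linarith) one_pos
  have hη1 : η ≤ 1 := min_le_right _ _
  have hηη : η < η₀ := (min_le_left _ _).trans_lt (by linarith)
  set M := ∫ s in Set.Ioi η, (1 + |κ|) * (d * s ^ (-(d + 1))) with hM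
  filter_upwards [hI.eventually_gt_atTop (2 * M / ε), hI.eventually_gt_atTop 0,
    self_mem_nhdsWithin] with δ hδM hI0 hδ
  have hδ0 : 0 < δ := hδ
  have hk := integrableOn_poissonProfileDeriv hd hδ0
  have hkF : IntegrableOn (fun s => poissonProfileDeriv d δ s * F s) (Set.Ioi 0) :=
    hk.mul_bdd (c := 1) hFm.aestronglyMeasurable (ae_of_all _ hF1)
  have hkG : IntegrableOn (fun s => poissonProfileDeriv d δ s * G s) (Set.Ioi 0) :=
    hk.mul_bdd (c := 1) hGm.aestronglyMeasurable (ae_of_all _ hG1)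
  have hμ := integral_poissonProfile_eq_neg hd hδ0 hy hpos
  have hU := integral_poissonProfile_eq_neg (μ := volume.restrict (Set.Ioc (0 : ℝ) 1)) hd hδ0
    (y := fun x => x) measurable_id
    ((ae_restrict_iff' measurableSet_Ioc).2 (ae_of_all _ fun x hx => hx.1))
  set I := ∫ s in Set.Ioc (0 : ℝ) 1, poissonProfile d δ s with hIdef
  have hc : Continuous (poissonProfile d δ) :=
    continuous_iff_continuousAt.2 fun s => (hasDerivAt_poissonProfile d hδ0 s).continuousAt
  have hdiff : (∫ x, poissonProfile d δ (y x) ∂μ) - κ * I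
      = -∫ s in Set.Ioi 0, poissonProfileDeriv d δ s * (F s - κ * G s) := by
    have h1 : ∫ s in Set.Ioi 0, poissonProfileDeriv d δ s * (F s - κ * G s)
        = (∫ s in Set.Ioi 0, poissonProfileDeriv d δ s * F s)
          - κ * ∫ s in Set.Ioi 0, poissonProfileDeriv d δ s * G s := by
      rw [← integral_const_mul, ← integral_sub hkF (hkG.const_mul κ)]
      congr 1
      ext s
      ring
    rw [hμ, hU, h1]
    ring
  have hi1 : IntegrableOn ((Set.Ioc (0 : ℝ) 1).indicator fun s => ε / 2 * poissonProfile d δ s)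
      (Set.Ioi 0) := by
    refine Integrable.integrableOn ?_
    rw [integrable_indicator_iff measurableSet_Ioc]
    exact (Continuous.integrableOn_Icc (by fun_prop)).mono_set Set.Ioc_subset_Icc_self
  have hi2 : IntegrableOn ((Set.Ioi η).indicator fun s => (1 + |κ|) * (d * s ^ (-(d + 1))))
      (Set.Ioi 0) := by
    refine Integrable.integrableOn ?_
    rw [integrable_indicator_iff measurableSet_Ioi]
    exact ((integrableOn_Ioi_rpow_neg_add_one hd hηpos).const_mul d).const_mul _
  have hbound : |∫ s in Set.Ioi 0, poissonProfileDeriv d δ s * (F s - κ * G s)|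
      ≤ ε / 2 * I + M := by
    have hle := norm_integral_le_of_norm_le (μ := volume.restrict (Set.Ioi 0))
      (f := fun s => poissonProfileDeriv d δ s * (F s - κ * G s)) (hi1.add hi2) ?_
    · refine hle.trans (le_of_eq ?_)
      simp only [Pi.add_apply]
      rw [integral_add hi1 hi2, setIntegral_indicator measurableSet_Ioc,
        setIntegral_indicator measurableSet_Ioi,
        Set.inter_eq_self_of_subset_right Set.Ioc_subset_Ioi_self,
        Set.inter_eq_self_of_subset_right (Set.Ioi_subset_Ioi hηpos.le), integral_const_mul]
    · refine (ae_restrict_iff' measurableSet_Ioi).2 (ae_of_all _ fun s hs => ?_)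
      have hs0 : (0 : ℝ) < s := hs
      have hg0 := poissonProfile_nonneg d δ hs0.le
      rw [norm_mul, Real.norm_eq_abs, Real.norm_eq_abs]
      simp only [Pi.add_apply]
      rcases le_or_gt s η with hsη | hsη
      · rw [Set.indicator_of_mem (show s ∈ Set.Ioc (0 : ℝ) 1 from ⟨hs0, hsη.trans hη1⟩),
          Set.indicator_of_notMem (by simpa using hsη), add_zero, hGs s hs0 (hsη.trans hη1)]
        have h1 : |F s - κ * s| ≤ ε / (2 * d) * s := by
          have h2 := (hη₀' s hs0 (hsη.trans_lt hηη)).le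
          have h3 : F s - κ * s = (F s / s - κ) * s := by field_simp
          rw [h3, abs_mul, abs_of_pos hs0]
          gcongr
        calc _ ≤ |poissonProfileDeriv d δ s| * (ε / (2 * d) * s) := by gcongr
          _ = ε / (2 * d) * (s * |poissonProfileDeriv d δ s|) := by ring
          _ ≤ ε / (2 * d) * (d * poissonProfile d δ s) := by
              exact mul_le_mul_of_nonneg_left (mul_abs_poissonProfileDeriv_le hd hδ0 hs0.le)
                (by positivity)
          _ = ε / 2 * poissonProfile d δ s := by field_simp
      · rw [Set.indicator_of_mem (show s ∈ Set.Ioi η from hsη)]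
        have h0 : 0 ≤ (Set.Ioc (0 : ℝ) 1).indicator (fun s => ε / 2 * poissonProfile d δ s) s :=
          Set.indicator_nonneg (fun x hx => by
            have := poissonProfile_nonneg d δ hx.1.le
            positivity) s
        have h1 : |F s - κ * G s| ≤ 1 + |κ| := by
          refine (abs_sub _ _).trans ?_
          rw [abs_mul]
          have := mul_le_mul_of_nonneg_left (hG1 s) (abs_nonneg κ)
          linarith [hF1 s]
        have h2 := abs_poissonProfileDeriv_le_rpow hd hδ0 hs0
        have h3 : |poissonProfileDeriv d δ s| * |F s - κ * G s|
            ≤ d * s ^ (-(d + 1)) * (1 + |κ|) := by gcongr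
        linarith
  rw [Real.dist_eq, show (∫ x, poissonProfile d δ (y x) ∂μ) / I - κ
    = ((∫ x, poissonProfile d δ (y x) ∂μ) - κ * I) / I by field_simp, hdiff, abs_div, abs_neg,
    abs_of_pos hI0, div_lt_iff₀ hI0]
  rw [div_lt_iff₀ hε] at hδM
  linarith

/-! ### Expectations of the profile under a one-sided stable law -/

theorem continuousAt_poissonProfile_zero {d : ℝ} {s : ℝ} (hs : 0 < s) :
    ContinuousAt (fun δ => poissonProfile d δ s) 0 := by
  unfold poissonProfile
  refine ContinuousAt.div continuousAt_const ?_ ?_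
  · refine ContinuousAt.rpow_const (by fun_prop) (Or.inl ?_)
    positivity
  · positivity

theorem tendsto_rpow_mul_poissonProfile {d : ℝ} (s : ℝ) :
    Tendsto (fun δ => δ ^ (d + 1) * poissonProfile d δ s) atTop (𝓝 s) := by
  have h0 : Tendsto (fun δ : ℝ => (s / δ) ^ 2 + 1) atTop (𝓝 1) := by
    have := ((tendsto_const_nhds (x := s)).div_atTop (tendsto_id (α := ℝ))).pow 2
    simpa using this.add_const 1
  have h1 := (h0.rpow_const (p := (d + 1) / 2) (Or.inl one_ne_zero))
  rw [Real.one_rpow] at h1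
  have h2 := (tendsto_const_nhds (x := s)).div h1 one_ne_zero
  rw [div_one] at h2
  refine h2.congr' ?_
  filter_upwards [eventually_gt_atTop 0] with δ hδ
  unfold poissonProfile
  rw [show s ^ 2 + δ ^ 2 = δ ^ 2 * ((s / δ) ^ 2 + 1) by field_simp,
    Real.mul_rpow (by positivity) (by positivity), ← Real.rpow_natCast δ 2, ← Real.rpow_mul hδ.le,
    show ((2 : ℕ) : ℝ) * ((d + 1) / 2) = d + 1 by push_cast; ring]
  have := Real.rpow_pos_of_pos hδ (d + 1)
  simp only [Pi.div_apply]
  field_simp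

theorem rpow_mul_poissonProfile_le {d : ℝ} (hd : 1 ≤ d) {δ : ℝ} (hδ : 0 < δ) {s : ℝ}
    (hs : 0 ≤ s) : δ ^ (d + 1) * poissonProfile d δ s ≤ s := by
  have h1 : δ ^ (d + 1) ≤ (s ^ 2 + δ ^ 2) ^ ((d + 1) / 2) := by
    calc δ ^ (d + 1) = (δ ^ 2) ^ ((d + 1) / 2) := by
          rw [← Real.rpow_natCast δ 2, ← Real.rpow_mul hδ.le]
          congr 1
          push_cast
          ring
      _ ≤ _ := Real.rpow_le_rpow (by positivity) (by nlinarith [sq_nonneg s]) (by linarith)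
  unfold poissonProfile
  have hp : 0 < (s ^ 2 + δ ^ 2) ^ ((d + 1) / 2) := by positivity
  rw [← mul_div_assoc, div_le_iff₀ hp, mul_comm]
  gcongr

namespace IsStableLaw

variable {β : ℝ} {μ : Measure ℝ} [IsProbabilityMeasure μ]

/-- The behaviour at large distances of the profile averaged over the stable law. -/
theorem tendsto_integral_poissonProfile_atTop (h : IsStableLaw β μ) (hβ0 : 0 < β) (hβ1 : β < 1)
    {d : ℝ} (hd : 1 ≤ d) :
    Tendsto (fun L => L ^ (d + β) * ∫ x, poissonProfile d L x ∂μ) atTop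
      (𝓝 (1 / Real.Gamma (1 - β) * (β * Real.Gamma ((1 - β) / 2) * Real.Gamma ((d + β) / 2)
        / (2 * Real.Gamma ((d + 1) / 2))))) := by
  set C := 1 / (1 - Real.exp (-1)) with hC
  have hk := (continuous_poissonProfileDeriv d one_pos)
  have hscale : ∀ L : ℝ, 0 < L → ∀ v : ℝ, 0 < v →
      L ^ β * μ.real {x | v < x / L}
        = v ^ (-β) * ((L * v) ^ β * μ.real {x | L * v < x}) := by
    intro L hL v hv
    have e : {x : ℝ | v < x / L} = {x | L * v < x} := by
      ext x
      simp [lt_div_iff₀ hL, mul_comm]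
    have hvb := Real.rpow_pos_of_pos hv β
    rw [e, Real.mul_rpow hL.le hv.le, Real.rpow_neg hv.le]
    field_simp
  have hrepr : ∀ L : ℝ, 0 < L → L ^ (d + β) * ∫ x, poissonProfile d L x ∂μ
      = ∫ v in Set.Ioi 0, poissonProfileDeriv d 1 v * (L ^ β * μ.real {x | v < x / L}) := by
    intro L hL
    have h1 := integral_poissonProfile_eq (μ := μ) hd one_pos (y := fun x => x / L)
      (by fun_prop) (by filter_upwards [h.pos] with x hx using div_pos hx hL)
    have e1 : ∀ x, poissonProfile d L x = L ^ (-d) * poissonProfile d 1 (x / L) := by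
      intro x
      have := poissonProfile_mul d hL 1 (x / L)
      rwa [mul_one, mul_div_cancel₀ _ hL.ne'] at this
    simp only [e1]
    rw [integral_const_mul, h1, ← mul_assoc, ← Real.rpow_add hL,
      show d + β + -d = β by ring, ← integral_const_mul]
    congr 1
    ext v
    ring
  rw [← integral_poissonProfileDeriv_mul_rpow hd hβ0 hβ1, ← integral_const_mul]
  have hdom : Tendsto (fun L : ℝ => ∫ v in Set.Ioi 0,
      poissonProfileDeriv d 1 v * (L ^ β * μ.real {x | v < x / L})) atTop
      (𝓝 (∫ v in Set.Ioi 0, 1 / Real.Gamma (1 - β) * (poissonProfileDeriv d 1 v * v ^ (-β)))) := by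
    refine tendsto_integral_filter_of_dominated_convergence
      (fun v => C * (d * (v ^ (-β) * (1 / (v ^ 2 + 1) ^ ((d + 1) / 2))))) ?_ ?_ ?_ ?_
    · refine Eventually.of_forall fun L => ?_
      have : Antitone fun v : ℝ => μ.real {x | v < x / L} := fun v w hvw =>
        measureReal_mono fun x hx => lt_of_le_of_lt hvw hx
      exact (hk.measurable.mul (this.measurable.const_mul _)).aestronglyMeasurable
    · filter_upwards [eventually_gt_atTop 0] with L hL
      refine (ae_restrict_iff' measurableSet_Ioi).2 (ae_of_all _ fun v hv => ?_)
      have hv0 : (0 : ℝ) < v := hv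
      rw [hscale L hL v hv0, norm_mul, Real.norm_eq_abs, Real.norm_of_nonneg (by positivity)]
      have h1 := abs_poissonProfileDeriv_le hd one_pos v
      rw [one_pow] at h1
      have h2 := h.tail_le (mul_pos hL hv0)
      calc _ ≤ d * (1 / (v ^ 2 + 1) ^ ((d + 1) / 2)) * (v ^ (-β) * C) := by gcongr
        _ = _ := by ring
    · exact ((integrableOn_and_integral_rpow_neg_mul_sq_add_one_rpow hβ1
        (by linarith)).1.const_mul d).const_mul C
    · refine (ae_restrict_iff' measurableSet_Ioi).2 (ae_of_all _ fun v hv => ?_)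
      have hv0 : (0 : ℝ) < v := hv
      have h1 : Tendsto (fun L : ℝ => L * v) atTop atTop := tendsto_id.atTop_mul_const hv0
      have h2 := (((h.tendsto_tail hβ0 hβ1).comp h1).const_mul (v ^ (-β))).const_mul
        (poissonProfileDeriv d 1 v)
      rw [show 1 / Real.Gamma (1 - β) * (poissonProfileDeriv d 1 v * v ^ (-β))
        = poissonProfileDeriv d 1 v * (v ^ (-β) * (1 / Real.Gamma (1 - β))) by ring]
      refine h2.congr' ?_
      filter_upwards [eventually_gt_atTop 0] with L hL
      rw [hscale L hL v hv0]
      rfl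
  refine hdom.congr' ?_
  filter_upwards [eventually_gt_atTop 0] with L hL
  rw [hrepr L hL]

/-- The behaviour at small distances of the profile averaged over the stable law. -/
theorem tendsto_integral_poissonProfile_zero (h : IsStableLaw β μ) (hβ0 : 0 < β)
    {d : ℝ} (hd : 1 ≤ d) :
    Tendsto (fun L => ∫ x, poissonProfile d L x ∂μ) (𝓝 0)
      (𝓝 (Real.Gamma (d / β) / (β * Real.Gamma d))) := by
  obtain ⟨hi, hv⟩ := h.integrable_rpow_neg_and_integral hβ0 (a := d) (by linarith)
  rw [← hv]
  refine tendsto_integral_filter_of_dominated_convergence (fun x => x ^ (-d)) ?_ ?_ hi ?_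
  · exact Eventually.of_forall fun L => (measurable_poissonProfile d L).aestronglyMeasurable
  · refine Eventually.of_forall fun L => ?_
    filter_upwards [h.pos] with x hx
    rw [Real.norm_of_nonneg (poissonProfile_nonneg d L hx.le)]
    exact poissonProfile_le hd L hx
  · filter_upwards [h.pos] with x hx
    have := (continuousAt_poissonProfile_zero (d := d) hx).tendsto
    rwa [poissonProfile_zero d hx] at this

/-- The behaviour at large distances of the profile averaged over the law of `X ^ (-β)`. -/
theorem tendsto_integral_poissonProfile_rpow_atTop (h : IsStableLaw β μ) (hβ0 : 0 < β)
    {d : ℝ} (hd : 1 ≤ d) :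
    Tendsto (fun δ => δ ^ (d + 1) * ∫ x, poissonProfile d δ (x ^ (-β)) ∂μ) atTop
      (𝓝 (1 / (β * Real.Gamma β))) := by
  obtain ⟨hi, hv⟩ := h.integrable_rpow_neg_and_integral hβ0 hβ0
  rw [div_self hβ0.ne', Real.Gamma_one] at hv
  rw [← hv]
  simp only [← integral_const_mul]
  refine tendsto_integral_filter_of_dominated_convergence (fun x => x ^ (-β)) ?_ ?_ hi ?_
  · refine Eventually.of_forall fun L => ?_
    exact (((measurable_poissonProfile d L).comp (by fun_prop)).const_mul _).aestronglyMeasurable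
  · filter_upwards [eventually_gt_atTop 0] with δ hδ
    filter_upwards [h.pos] with x hx
    have hx' := Real.rpow_pos_of_pos hx (-β)
    have := poissonProfile_nonneg d δ hx'.le
    rw [Real.norm_of_nonneg (by positivity)]
    exact rpow_mul_poissonProfile_le hd hδ hx'.le
  · exact ae_of_all _ fun x => tendsto_rpow_mul_poissonProfile _

/-- The distribution function of `X ^ (-β)` near `0`, a reformulation of the tail of `X`. -/
theorem tendsto_measureReal_rpow_neg_lt_div (h : IsStableLaw β μ) (hβ0 : 0 < β) (hβ1 : β < 1) :
    Tendsto (fun s => μ.real {x | x ^ (-β) < s} / s) (𝓝[>] 0)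
      (𝓝 (1 / Real.Gamma (1 - β))) := by
  have hu : Tendsto (fun s : ℝ => s ^ (-(1 / β))) (𝓝[>] 0) atTop := by
    exact tendsto_rpow_neg_nhdsGT_zero (by simpa using hβ0)
  refine ((h.tendsto_tail hβ0 hβ1).comp hu).congr' ?_
  filter_upwards [self_mem_nhdsWithin] with s hs
  have hs0 : (0 : ℝ) < s := hs
  have e : μ.real {x | x ^ (-β) < s} = μ.real {x | s ^ (-(1 / β)) < x} := by
    refine measureReal_congr ?_
    filter_upwards [h.pos] with x hx
    refine propext ?_
    have h1 : x ^ (-β) < s ↔ s ^ (-(1 / β)) < x := by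
      rw [show -(1 / β) = (-β)⁻¹ by field_simp]
      exact (Real.rpow_inv_lt_iff_of_neg hs0 hx (by linarith)).symm
    exact h1
  simp only [Function.comp]
  rw [e, ← Real.rpow_mul hs0.le, show -(1 / β) * β = -1 by field_simp, Real.rpow_neg_one]
  ring

/-- The behaviour at small distances of the profile averaged over the law of `X ^ (-β)`, in
dimension one. -/
theorem tendsto_integral_poissonProfile_one_div_log (h : IsStableLaw β μ) (hβ0 : 0 < β)
    (hβ1 : β < 1) :
    Tendsto (fun δ => (∫ x, poissonProfile 1 δ (x ^ (-β)) ∂μ) / -Real.log δ) (𝓝[>] 0)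
      (𝓝 (1 / Real.Gamma (1 - β))) := by
  have hlog : Tendsto (fun δ : ℝ => -Real.log δ) (𝓝[>] 0) atTop :=
    tendsto_neg_atBot_atTop.comp Real.tendsto_log_nhdsGT_zero
  have hlog1 : Tendsto (fun δ : ℝ => Real.log (1 + δ ^ 2) / 2) (𝓝[>] 0) (𝓝 0) := by
    have : ContinuousAt (fun δ : ℝ => Real.log (1 + δ ^ 2) / 2) 0 :=
      ContinuousAt.div_const (ContinuousAt.log (by fun_prop) (by norm_num)) 2
    have h2 := this.tendsto
    simp only [ne_eq, OfNat.ofNat_ne_zero, not_false_eq_true, zero_pow, add_zero, Real.log_one,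
      zero_div] at h2
    exact h2.mono_left nhdsWithin_le_nhds
  have hIe : ∀ᶠ δ : ℝ in 𝓝[>] 0, Real.log (1 + δ ^ 2) / 2 + -Real.log δ
      = ∫ s in Set.Ioc (0 : ℝ) 1, poissonProfile 1 δ s := by
    filter_upwards [self_mem_nhdsWithin] with δ hδ
    rw [integral_Ioc_poissonProfile_one hδ]
    ring
  have hI := (hlog1.add_atTop hlog).congr' hIe
  have h1 := tendsto_integral_poissonProfile_div (μ := μ) le_rfl (y := fun x => x ^ (-β))
    (by fun_prop) (by filter_upwards [h.pos] with x hx using Real.rpow_pos_of_pos hx _)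
    (h.tendsto_measureReal_rpow_neg_lt_div hβ0 hβ1) hI
  have h2 := (hlog1.div_atTop hlog).add_const 1
  have h3 := h1.mul h2
  rw [zero_add, mul_one] at h3
  refine h3.congr' ?_
  filter_upwards [hIe, hlog.eventually_gt_atTop 0, hI.eventually_gt_atTop 0] with δ hδ hl hI0
  rw [← hδ] at hI0 ⊢
  generalize -Real.log δ = l at hl hI0 ⊢
  generalize Real.log (1 + δ ^ 2) / 2 = m at hI0 ⊢
  field_simp

/-- The behaviour at small distances of the profile averaged over the law of `X ^ (-β)`, in
dimension greater than one. -/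
theorem tendsto_rpow_mul_integral_poissonProfile_rpow (h : IsStableLaw β μ) (hβ0 : 0 < β)
    (hβ1 : β < 1) {d : ℝ} (hd : 1 < d) :
    Tendsto (fun δ => δ ^ (d - 1) * ∫ x, poissonProfile d δ (x ^ (-β)) ∂μ) (𝓝[>] 0)
      (𝓝 (1 / Real.Gamma (1 - β) * (1 / (d - 1)))) := by
  have hpow : Tendsto (fun δ : ℝ => (1 + δ ^ 2) ^ ((1 - d) / 2)) (𝓝[>] 0) (𝓝 1) := by
    have : ContinuousAt (fun δ : ℝ => (1 + δ ^ 2) ^ ((1 - d) / 2)) 0 :=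
      ContinuousAt.rpow_const (by fun_prop) (Or.inl (by norm_num))
    have h2 := this.tendsto
    simp only [ne_eq, OfNat.ofNat_ne_zero, not_false_eq_true, zero_pow, add_zero,
      Real.one_rpow] at h2
    exact h2.mono_left nhdsWithin_le_nhds
  have hbig : Tendsto (fun δ : ℝ => δ ^ (1 - d)) (𝓝[>] 0) atTop := by
    have := tendsto_rpow_neg_nhdsGT_zero (y := 1 - d) (by linarith)
    exact this
  have hIe : ∀ᶠ δ : ℝ in 𝓝[>] 0, (δ ^ (1 - d) + -(1 + δ ^ 2) ^ ((1 - d) / 2)) / (d - 1)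
      = ∫ s in Set.Ioc (0 : ℝ) 1, poissonProfile d δ s := by
    filter_upwards [self_mem_nhdsWithin] with δ hδ
    rw [integral_Ioc_poissonProfile_of_one_lt hd hδ]
    ring
  have hd1 : 0 < d - 1 := by linarith
  have hI := ((hbig.atTop_add hpow.neg).atTop_div_const hd1).congr' hIe
  have h1 := tendsto_integral_poissonProfile_div (μ := μ) hd.le (y := fun x => x ^ (-β))
    (by fun_prop) (by filter_upwards [h.pos] with x hx using Real.rpow_pos_of_pos hx _)
    (h.tendsto_measureReal_rpow_neg_lt_div hβ0 hβ1) hI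
  have h2 : Tendsto (fun δ : ℝ => (1 - (1 + δ ^ 2) ^ ((1 - d) / 2) / δ ^ (1 - d)) / (d - 1))
      (𝓝[>] 0) (𝓝 (1 / (d - 1))) := by
    simpa using ((hpow.div_atTop hbig).const_sub 1).div_const (d - 1)
  refine (h1.mul h2).congr' ?_
  filter_upwards [hIe, self_mem_nhdsWithin, hI.eventually_gt_atTop 0] with δ hδ hδ0 hI0
  have hδ0' : (0 : ℝ) < δ := hδ0
  rw [← hδ] at hI0 ⊢
  rw [show d - 1 = -(1 - d) by ring, Real.rpow_neg hδ0'.le]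
  have hp := Real.rpow_pos_of_pos hδ0' (1 - d)
  have hne : δ ^ (1 - d) - (1 + δ ^ 2) ^ ((1 - d) / 2) ≠ 0 := by
    intro h0
    rw [← sub_eq_add_neg, h0, zero_div] at hI0
    exact lt_irrefl _ hI0
  have hd2 : 1 - d ≠ 0 := by linarith
  rw [← sub_eq_add_neg]
  field_simp

end IsStableLaw

/-! ### Laws of the stable subordinator and of its inverse -/

namespace IsStableSubordinator

variable {Ω : Type*} [MeasurableSpace Ω] {P : Measure Ω} {β : ℝ} {S : ℝ≥0 → Ω → ℝ}

theorem ae_nonneg (hS : IsStableSubordinator P β S) (t : ℝ≥0) : ∀ᵐ ω ∂P, 0 ≤ S t ω := by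
  filter_upwards [hS.start_zero, hS.monotone_paths] with ω h0 hm
  rw [← h0]
  exact hm zero_le

variable [IsProbabilityMeasure P]

/-- Chernoff's bound for the lower tail of `S t`. -/
theorem measureReal_le (hS : IsStableSubordinator P β S) (t : ℝ≥0) (a : ℝ) {r : ℝ} (hr : 0 < r) :
    P.real {ω | S t ω ≤ a} ≤ Real.exp (r * a - t * r ^ β) := by
  have hint : Integrable (fun ω => Real.exp (-r * S t ω)) P := by
    refine Integrable.of_bound (C := 1) ?_ ?_
    · exact (Real.measurable_exp.comp ((hS.measurable t).const_mul _)).aestronglyMeasurable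
    · filter_upwards [hS.ae_nonneg t] with ω hω
      rw [Real.norm_of_nonneg (Real.exp_pos _).le]
      simpa using mul_nonneg hr.le hω
  refine (measure_le_le_exp_mul_mgf a (neg_nonpos.2 hr.le) hint).trans (le_of_eq ?_)
  rw [mgf, hS.laplace t r hr, ← Real.exp_add]
  ring_nf

theorem ae_pos (hS : IsStableSubordinator P β S) (hβ : 0 < β) {t : ℝ≥0} (ht : 0 < t) :
    ∀ᵐ ω ∂P, 0 < S t ω := by
  have ht' : (0 : ℝ) < t := ht
  have hlim : Tendsto (fun r : ℝ => Real.exp (r * 0 - t * r ^ β)) atTop (𝓝 0) := by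
    refine Real.tendsto_exp_atBot.comp ?_
    have := (tendsto_rpow_atTop hβ).const_mul_atTop ht'
    refine (tendsto_neg_atTop_atBot.comp this).congr fun r => ?_
    simp
  have h0 : P.real {ω | S t ω ≤ 0} ≤ 0 := by
    refine ge_of_tendsto hlim ?_
    filter_upwards [eventually_gt_atTop 0] with r hr using hS.measureReal_le t 0 hr
  have h1 : P {ω | S t ω ≤ 0} = 0 := by
    rw [← measureReal_eq_zero_iff]
    exact le_antisymm h0 measureReal_nonneg
  rw [ae_iff]
  simpa using h1

theorem ae_exists_lt (hS : IsStableSubordinator P β S) (a : ℝ) : ∀ᵐ ω ∂P, ∃ s, a < S s ω := by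
  have hlim : Tendsto (fun n : ℕ => Real.exp (1 * a - ((n : ℝ≥0) : ℝ) * 1 ^ β)) atTop (𝓝 0) := by
    refine Real.tendsto_exp_atBot.comp ?_
    have := tendsto_atBot_add_const_left atTop a
      (tendsto_neg_atTop_atBot.comp (tendsto_natCast_atTop_atTop (R := ℝ)))
    simpa [sub_eq_add_neg] using this
  have h0 : P.real {ω | ∀ s, S s ω ≤ a} ≤ 0 := by
    refine ge_of_tendsto' hlim fun n => ?_
    exact (measureReal_mono fun ω (hω : ∀ s, S s ω ≤ a) => hω n).trans
      (hS.measureReal_le n a one_pos)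
  have h1 : P {ω | ∀ s, S s ω ≤ a} = 0 := by
    rw [← measureReal_eq_zero_iff]
    exact le_antisymm h0 measureReal_nonneg
  rw [ae_iff]
  simpa using h1

theorem isProbabilityMeasure_map (hS : IsStableSubordinator P β S) (t : ℝ≥0) :
    IsProbabilityMeasure (P.map (S t)) :=
  Measure.isProbabilityMeasure_map (hS.measurable t).aemeasurable

theorem isStableLaw_map_one (hS : IsStableSubordinator P β S) (hβ : 0 < β) :
    IsStableLaw β (P.map (S 1)) where
  pos := (ae_map_iff (hS.measurable 1).aemeasurable measurableSet_Ioi).2 (hS.ae_pos hβ one_pos)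
  laplace r hr := by
    rw [integral_map (hS.measurable 1).aemeasurable (by fun_prop), hS.laplace 1 r hr]
    simp

/-- Self-similarity of the stable subordinator. -/
theorem map_eq (hS : IsStableSubordinator P β S) (hβ : 0 < β) {t : ℝ≥0} (ht : 0 < t) :
    P.map (S t) = (P.map (S 1)).map fun x => (t : ℝ) ^ (1 / β) * x := by
  have ht' : (0 : ℝ) < t := ht
  have hc := Real.rpow_pos_of_pos ht' (1 / β)
  have h1 := hS.isProbabilityMeasure_map 1
  have h2 := hS.isProbabilityMeasure_map t
  have hm : Measurable fun x : ℝ => (t : ℝ) ^ (1 / β) * x := by fun_prop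
  have h3 : IsProbabilityMeasure ((P.map (S 1)).map fun x => (t : ℝ) ^ (1 / β) * x) :=
    Measure.isProbabilityMeasure_map hm.aemeasurable
  refine Measure.ext_of_laplace ?_ ?_ fun r hr => ?_
  · exact (ae_map_iff (hS.measurable t).aemeasurable measurableSet_Ici).2 (hS.ae_nonneg t)
  · refine (ae_map_iff hm.aemeasurable measurableSet_Ici).2 ?_
    filter_upwards [(hS.isStableLaw_map_one hβ).pos] with x hx using (mul_pos hc hx).le
  · rw [integral_map (hS.measurable t).aemeasurable (by fun_prop),
      integral_map hm.aemeasurable (by fun_prop), hS.laplace t r hr]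
    have := (hS.isStableLaw_map_one hβ).laplace (r * (t : ℝ) ^ (1 / β)) (by positivity)
    rw [Real.mul_rpow hr.le hc.le, ← Real.rpow_mul ht'.le, one_div_mul_cancel hβ.ne',
      Real.rpow_one] at this
    rw [show -(t : ℝ) * r ^ β = -(r ^ β * t) by ring, ← this]
    congr 1
    ext x
    ring_nf

/-- Off a null set, `S⁻¹_t > s` holds exactly if `S` has not passed `t` at some time after `s`.
The exceptional set contains the bounded paths, on which the infimum is over the empty set. -/
theorem setOf_lt_inverseProcess_ae_eq (hS : IsStableSubordinator P β S) (t s : ℝ≥0) :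
    {ω | (s : ℝ) < inverseProcess S t ω}
      =ᵐ[P] ⋃ k : ℕ, {ω | S (s + 1 / ((k : ℝ≥0) + 1)) ω ≤ t} := by
  filter_upwards [hS.monotone_paths, hS.ae_exists_lt t] with ω hm hex
  refine propext ?_
  change (s : ℝ) < inverseProcess S t ω ↔ ω ∈ ⋃ k : ℕ, {ω | S (s + 1 / ((k : ℝ≥0) + 1)) ω ≤ t}
  simp only [Set.mem_iUnion, Set.mem_ofPred_eq]
  unfold inverseProcess
  rw [NNReal.coe_lt_coe]
  have hne : {u : ℝ≥0 | (t : ℝ) < S u ω}.Nonempty := hex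
  constructor
  · intro hlt
    obtain ⟨ε, hε, hε'⟩ : ∃ ε : ℝ≥0, 0 < ε ∧ s + ε = sInf {u : ℝ≥0 | (t : ℝ) < S u ω} :=
      ⟨_, tsub_pos_of_lt hlt, add_tsub_cancel_of_le hlt.le⟩
    obtain ⟨k, hk⟩ := exists_nat_one_div_lt hε
    refine ⟨k, not_lt.1 fun hcon => ?_⟩
    have h1 := csInf_le (OrderBot.bddBelow _) (show s + 1 / ((k : ℝ≥0) + 1)
      ∈ {u : ℝ≥0 | (t : ℝ) < S u ω} from hcon)
    rw [← hε'] at h1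
    exact absurd hk (not_lt.2 (le_of_add_le_add_left h1))
  · rintro ⟨k, hk⟩
    have hpos : (0 : ℝ≥0) < 1 / ((k : ℝ≥0) + 1) := by positivity
    refine (lt_add_of_pos_right s hpos).trans_le (le_csInf hne fun u hu => ?_)
    by_contra hcon
    exact absurd (hm (not_le.1 hcon).le) (not_le.2 (hk.trans_lt hu))

theorem aemeasurable_inverseProcess (hS : IsStableSubordinator P β S) (t : ℝ≥0) :
    AEMeasurable (inverseProcess S t) P := by
  refine NullMeasurable.aemeasurable ?_
  suffices h : @Measurable (NullMeasurableSpace Ω P) ℝ _ _ (inverseProcess S t) from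
    fun s hs => h hs
  refine measurable_of_Ioi fun s => ?_
  change NullMeasurableSet {ω | s < inverseProcess S t ω} P
  rcases lt_or_ge s 0 with hs | hs
  · convert MeasurableSet.univ.nullMeasurableSet
    exact Set.eq_univ_of_forall fun ω => hs.trans_le (NNReal.coe_nonneg _)
  · lift s to ℝ≥0 using hs
    refine NullMeasurableSet.congr ?_ (hS.setOf_lt_inverseProcess_ae_eq t s).symm
    exact (MeasurableSet.iUnion fun k =>
      measurableSet_le (hS.measurable _) measurable_const).nullMeasurableSet

theorem measure_le_eq (hS : IsStableSubordinator P β S) (hβ : 0 < β) (t : ℝ≥0) {u : ℝ≥0}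
    (hu : 0 < u) :
    P {ω | S u ω ≤ t} = P.map (S 1) {x | (u : ℝ) ≤ ((t : ℝ) / x) ^ β} := by
  have hu' : (0 : ℝ) < u := hu
  have hm : Measurable fun x : ℝ => (u : ℝ) ^ (1 / β) * x := by fun_prop
  have h1 : P {ω | S u ω ≤ t} = P.map (S u) (Set.Iic (t : ℝ)) :=
    (Measure.map_apply (hS.measurable u) measurableSet_Iic).symm
  rw [h1, hS.map_eq hβ hu, Measure.map_apply hm measurableSet_Iic]
  refine measure_congr ?_
  filter_upwards [(hS.isStableLaw_map_one hβ).pos] with x hx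
  refine propext ?_
  change (u : ℝ) ^ (1 / β) * x ≤ t ↔ (u : ℝ) ≤ ((t : ℝ) / x) ^ β
  rw [one_div, ← le_div_iff₀ hx]
  exact Real.rpow_inv_le_iff_of_pos hu'.le (by positivity) hβ

/-- The inverse process at time `t` has the law of `(t / S 1) ^ β`. -/
theorem map_inverseProcess_eq (hS : IsStableSubordinator P β S) (hβ : 0 < β) (t : ℝ≥0) :
    P.map (inverseProcess S t) = (P.map (S 1)).map fun x => ((t : ℝ) / x) ^ β := by
  have h1 := hS.isProbabilityMeasure_map 1
  have hE := hS.aemeasurable_inverseProcess t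
  have hm : Measurable fun x : ℝ => ((t : ℝ) / x) ^ β := by fun_prop
  have h2 : IsProbabilityMeasure (P.map (inverseProcess S t)) :=
    Measure.isProbabilityMeasure_map hE
  have h3 : IsProbabilityMeasure ((P.map (S 1)).map fun x => ((t : ℝ) / x) ^ β) :=
    Measure.isProbabilityMeasure_map hm.aemeasurable
  have hpos := (hS.isStableLaw_map_one hβ).pos
  suffices h : ∀ s : ℝ, P.map (inverseProcess S t) (Set.Ioi s)
      = (P.map (S 1)).map (fun x => ((t : ℝ) / x) ^ β) (Set.Ioi s) by
    refine Measure.ext_of_Iic _ _ fun s => ?_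
    rw [← Set.compl_Ioi, prob_compl_eq_one_sub measurableSet_Ioi,
      prob_compl_eq_one_sub measurableSet_Ioi, h s]
  intro s
  rw [Measure.map_apply_of_aemeasurable hE measurableSet_Ioi,
    Measure.map_apply hm measurableSet_Ioi]
  rcases lt_or_ge s 0 with hs | hs
  · have e1 : inverseProcess S t ⁻¹' Set.Ioi s = Set.univ :=
      Set.eq_univ_of_forall fun ω => hs.trans_le (NNReal.coe_nonneg _)
    have e2 : (fun x : ℝ => ((t : ℝ) / x) ^ β) ⁻¹' Set.Ioi s =ᵐ[P.map (S 1)] Set.univ := by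
      filter_upwards [hpos] with x hx
      refine propext ?_
      change s < ((t : ℝ) / x) ^ β ↔ True
      have : 0 ≤ ((t : ℝ) / x) ^ β := by positivity
      simp only [iff_true]
      linarith
    rw [e1, measure_congr e2, measure_univ, measure_univ]
  · lift s to ℝ≥0 using hs
    have hu : ∀ k : ℕ, (0 : ℝ≥0) < s + 1 / ((k : ℝ≥0) + 1) := fun k => by positivity
    have hanti : Antitone fun k : ℕ => s + 1 / ((k : ℝ≥0) + 1) := by
      intro j k hjk
      dsimp only
      gcongr
    have e1 : P (inverseProcess S t ⁻¹' Set.Ioi (s : ℝ))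
        = ⨆ k : ℕ, P {ω | S (s + 1 / ((k : ℝ≥0) + 1)) ω ≤ t} := by
      refine (measure_congr (hS.setOf_lt_inverseProcess_ae_eq t s)).trans ?_
      -- the union is increasing only along monotone paths, hence the detour over partial unions
      rw [measure_iUnion_eq_iSup_accumulate]
      refine iSup_congr fun k => measure_congr ?_
      filter_upwards [hS.monotone_paths] with ω hmono
      refine propext ?_
      change ω ∈ Set.accumulate _ k ↔ S (s + 1 / ((k : ℝ≥0) + 1)) ω ≤ t
      rw [Set.mem_accumulate]
      constructor
      · rintro ⟨j, hj, hj'⟩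
        exact (hmono (hanti hj)).trans hj'
      · intro h
        exact ⟨k, le_rfl, h⟩
    have e2 : P.map (S 1) ((fun x : ℝ => ((t : ℝ) / x) ^ β) ⁻¹' Set.Ioi (s : ℝ))
        = ⨆ k : ℕ, P.map (S 1) {x | ((s + 1 / ((k : ℝ≥0) + 1) : ℝ≥0) : ℝ) ≤ ((t : ℝ) / x) ^ β} := by
      rw [← Monotone.measure_iUnion]
      · congr 1
        ext x
        simp only [Set.mem_preimage, Set.mem_Ioi, Set.mem_iUnion, Set.mem_ofPred_eq]
        constructor
        · intro hlt
          obtain ⟨k, hk⟩ := exists_nat_one_div_lt (sub_pos.2 hlt)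
          refine ⟨k, ?_⟩
          push_cast
          linarith
        · rintro ⟨k, hk⟩
          refine lt_of_lt_of_le ?_ hk
          exact_mod_cast lt_add_of_pos_right s (by positivity : (0 : ℝ≥0) < 1 / ((k : ℝ≥0) + 1))
      · intro j k hjk x hx
        exact (NNReal.coe_le_coe.2 (hanti hjk)).trans hx
    rw [e1, e2]
    exact iSup_congr fun k => hS.measure_le_eq hβ t (hu k)

end IsStableSubordinator

/-! ### The subordinated kernels in scaling form -/

/-- Asymptotic equivalence of functions that depend, up to a common factor `C`, on the single
scaling variable `A`. -/
theorem isEquivalent_of_scaling {α : Type*} {l : Filter α} {l' : Filter ℝ} {A C f g : α → ℝ}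
    {H : ℝ → ℝ} {K : ℝ} (hA : Tendsto A l l') (hH : Tendsto H l' (𝓝 K)) (hK : K ≠ 0)
    (hf : ∀ᶠ q in l, f q = C q * H (A q)) (hg : ∀ᶠ q in l, g q = C q * K) : f ~[l] g := by
  have h1 : (fun q => H (A q)) ~[l] fun _ => K :=
    (isEquivalent_const_iff_tendsto hK).2 (hH.comp hA)
  have h2 := (IsEquivalent.refl (u := C) (l := l)).mul h1
  exact (h2.congr_left (hf.mono fun q hq => hq.symm)).congr_right (hg.mono fun q hq => hq.symm)

/-- The normalising constant of the Cauchy kernel in dimension `d`. -/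
noncomputable def cauchyConst (d : ℝ) : ℝ := Real.pi ^ (-(d + 1) / 2) * Real.Gamma ((d + 1) / 2)

theorem cauchyKernel_eq (n : ℕ) (s : ℝ) (x y : EuclideanSpace ℝ (Fin n)) :
    cauchyKernel n s x y = cauchyConst n * poissonProfile n ‖x - y‖ s := by
  unfold cauchyKernel cauchyConst poissonProfile
  rw [mul_div_assoc]

theorem timeChangedKernel_cauchyKernel_eq {Ω : Type*} [MeasurableSpace Ω] {P : Measure Ω}
    {μ : Measure ℝ} {n : ℕ} {T : ℝ≥0 → Ω → ℝ} {t : ℝ≥0} {a : ℝ} (ha : 0 < a) {f : ℝ → ℝ}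
    (hf : Measurable f) (hpos : ∀ᵐ z ∂μ, 0 < f z)
    (h : P.map (T t) = μ.map fun z => a * f z) (x y : EuclideanSpace ℝ (Fin n)) :
    timeChangedKernel P (cauchyKernel n) T t x y
      = cauchyConst n * a ^ (-(n : ℝ)) * ∫ z, poissonProfile n (‖x - y‖ / a) (f z) ∂μ := by
  have hm : Measurable fun z => a * f z := hf.const_mul a
  unfold timeChangedKernel
  simp only [cauchyKernel_eq]
  have hae : ∀ᵐ s ∂(μ.map fun z => a * f z), s ∈ Set.Ioi (0 : ℝ) := by
    refine (ae_map_iff hm.aemeasurable measurableSet_Ioi).2 ?_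
    filter_upwards [hpos] with z hz using mul_pos ha hz
  rw [h, Measure.restrict_eq_self_of_ae_mem hae, integral_const_mul,
    integral_map hm.aemeasurable (measurable_poissonProfile _ _).aestronglyMeasurable, mul_assoc,
    ← integral_const_mul (a ^ (-(n : ℝ)))]
  refine congrArg (cauchyConst n * ·) (integral_congr_ae (ae_of_all _ fun z => ?_))
  simp only
  rw [← poissonProfile_mul _ ha, mul_div_cancel₀ _ ha.ne']

namespace IsStableSubordinator

variable {Ω : Type*} [MeasurableSpace Ω] {P : Measure Ω} [IsProbabilityMeasure P] {β : ℝ}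
  {S : ℝ≥0 → Ω → ℝ}

theorem timeChangedKernel_eq (hS : IsStableSubordinator P β S) (hβ : 0 < β) {n : ℕ} {t : ℝ≥0}
    (ht : 0 < t) (x y : EuclideanSpace ℝ (Fin n)) :
    timeChangedKernel P (cauchyKernel n) S t x y
      = cauchyConst n * (t : ℝ) ^ (-(n : ℝ) / β)
        * ∫ z, poissonProfile n (‖x - y‖ * (t : ℝ) ^ (-1 / β)) z ∂(P.map (S 1)) := by
  have ht' : (0 : ℝ) < t := ht
  rw [timeChangedKernel_cauchyKernel_eq (Real.rpow_pos_of_pos ht' (1 / β)) measurable_id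
    (hS.isStableLaw_map_one hβ).pos (hS.map_eq hβ ht) x y, ← Real.rpow_mul ht'.le,
    div_eq_mul_inv ‖x - y‖, ← Real.rpow_neg ht'.le,
    show 1 / β * -(n : ℝ) = -(n : ℝ) / β by ring, show -(1 / β) = -1 / β by ring]
  rfl

theorem timeChangedKernel_inverseProcess_eq (hS : IsStableSubordinator P β S) (hβ : 0 < β) {n : ℕ}
    {t : ℝ≥0} (ht : 0 < t) (x y : EuclideanSpace ℝ (Fin n)) :
    timeChangedKernel P (cauchyKernel n) (inverseProcess S) t x y
      = cauchyConst n * (t : ℝ) ^ (-(n : ℝ) * β)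
        * ∫ z, poissonProfile n (‖x - y‖ * (t : ℝ) ^ (-β)) (z ^ (-β)) ∂(P.map (S 1)) := by
  have ht' : (0 : ℝ) < t := ht
  have hpos := (hS.isStableLaw_map_one hβ).pos
  have hmap : P.map (inverseProcess S t) = (P.map (S 1)).map fun z => (t : ℝ) ^ β * z ^ (-β) := by
    rw [hS.map_inverseProcess_eq hβ t]
    refine Measure.map_congr ?_
    filter_upwards [hpos] with z hz
    rw [Real.div_rpow ht'.le hz.le, Real.rpow_neg hz.le, div_eq_mul_inv]
  rw [timeChangedKernel_cauchyKernel_eq (Real.rpow_pos_of_pos ht' β)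
    (f := fun z => z ^ (-β)) (by fun_prop)
    (by filter_upwards [hpos] with z hz using Real.rpow_pos_of_pos hz _) hmap x y,
    ← Real.rpow_mul ht'.le, div_eq_mul_inv ‖x - y‖, ← Real.rpow_neg ht'.le,
    show β * -(n : ℝ) = -(n : ℝ) * β by ring]

end IsStableSubordinator

/-- The constant for large distances, simplified by Legendre's duplication formula. -/
theorem cauchyConst_mul_subordination_const {d β : ℝ} (hd : 1 ≤ d) (hβ1 : β < 1) :
    cauchyConst d * (1 / Real.Gamma (1 - β) * (β * Real.Gamma ((1 - β) / 2)
        * Real.Gamma ((d + β) / 2) / (2 * Real.Gamma ((d + 1) / 2))))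
      = β * (2 : ℝ) ^ (β - 1) * Real.Gamma ((d + β) / 2)
        / (Real.pi ^ (d / 2) * Real.Gamma (1 - β / 2)) := by
  have hdup := Real.Gamma_mul_Gamma_add_half ((1 - β) / 2)
  rw [show (1 - β) / 2 + 1 / 2 = 1 - β / 2 by ring, show 2 * ((1 - β) / 2) = 1 - β by ring,
    show 1 - (1 - β) = β by ring] at hdup
  have h1 : 0 < Real.Gamma (1 - β) := Real.Gamma_pos_of_pos (by linarith)
  have h2 : 0 < Real.Gamma ((d + 1) / 2) := Real.Gamma_pos_of_pos (by linarith)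
  have h3 : 0 < Real.Gamma (1 - β / 2) := Real.Gamma_pos_of_pos (by linarith)
  have h4 : Real.Gamma ((1 - β) / 2) = Real.Gamma (1 - β) * 2 ^ β * √Real.pi
      / Real.Gamma (1 - β / 2) := by
    rw [eq_div_iff h3.ne', hdup]
  have hpi := Real.pi_pos
  have h5 : Real.pi ^ (-(d + 1) / 2) = (Real.pi ^ (d / 2) * √Real.pi)⁻¹ := by
    rw [Real.sqrt_eq_rpow, ← Real.rpow_add hpi, ← Real.rpow_neg hpi.le]
    ring_nf
  have h6 : (2 : ℝ) ^ (β - 1) = 2 ^ β / 2 := by rw [Real.rpow_sub two_pos, Real.rpow_one]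
  have h7 : 0 < Real.pi ^ (d / 2) := by positivity
  unfold cauchyConst
  rw [h4, h5, h6]
  field_simp

theorem pi_rpow_neg_div_two (d : ℝ) : Real.pi ^ (-(d + 1) / 2) = (Real.pi ^ ((d + 1) / 2))⁻¹ := by
  rw [← Real.rpow_neg Real.pi_pos.le, neg_div]

theorem rpow_mul_rpow_eq_rpow_neg {β ρ t : ℝ} (hβ : 0 < β) (hρ : 0 < ρ) (ht : 0 < t) :
    (ρ ^ (-1 / β) * t) ^ (-β) = ρ * t ^ (-β) := by
  rw [Real.mul_rpow (by positivity) ht.le, ← Real.rpow_mul hρ.le,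
    show -1 / β * -β = 1 by field_simp, Real.rpow_one]

theorem tendsto_mul_rpow_neg_of_atTop {E : Type*} [NormedAddCommGroup E] {β : ℝ} (hβ : 0 < β) :
    Tendsto (fun q : ℝ≥0 × E × E => ‖q.2.1 - q.2.2‖ * (q.1 : ℝ) ^ (-β))
      (alongTimeOffDiag (fun q => ‖q.2.1 - q.2.2‖ ^ (-1 / β) * (q.1 : ℝ)) atTop) (𝓝[>] 0) := by
  have hA : Tendsto (fun q : ℝ≥0 × E × E => ‖q.2.1 - q.2.2‖ ^ (-1 / β) * (q.1 : ℝ))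
      (alongTimeOffDiag (fun q => ‖q.2.1 - q.2.2‖ ^ (-1 / β) * (q.1 : ℝ)) atTop) atTop :=
    tendsto_comap.mono_left inf_le_left
  have hmem : ∀ᶠ q : ℝ≥0 × E × E in
      alongTimeOffDiag (fun q => ‖q.2.1 - q.2.2‖ ^ (-1 / β) * (q.1 : ℝ)) atTop,
      0 < q.1 ∧ q.2.1 ≠ q.2.2 := mem_inf_of_right (mem_principal_self _)
  refine tendsto_nhdsWithin_iff.2 ⟨((tendsto_rpow_neg_atTop hβ).comp hA).congr' ?_, ?_⟩
  · filter_upwards [hmem] with q hq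
    exact rpow_mul_rpow_eq_rpow_neg hβ (norm_pos_iff.2 (sub_ne_zero.2 hq.2)) hq.1
  · filter_upwards [hmem] with q hq
    have h1 := norm_pos_iff.2 (sub_ne_zero.2 hq.2)
    have h2 : (0 : ℝ) < q.1 := hq.1
    exact mul_pos h1 (Real.rpow_pos_of_pos h2 _)

theorem tendsto_mul_rpow_neg_of_zero {E : Type*} [NormedAddCommGroup E] {β : ℝ} (hβ : 0 < β) :
    Tendsto (fun q : ℝ≥0 × E × E => ‖q.2.1 - q.2.2‖ * (q.1 : ℝ) ^ (-β))
      (alongTimeOffDiag (fun q => ‖q.2.1 - q.2.2‖ ^ (-1 / β) * (q.1 : ℝ)) (𝓝 0)) atTop := by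
  have hA : Tendsto (fun q : ℝ≥0 × E × E => ‖q.2.1 - q.2.2‖ ^ (-1 / β) * (q.1 : ℝ))
      (alongTimeOffDiag (fun q => ‖q.2.1 - q.2.2‖ ^ (-1 / β) * (q.1 : ℝ)) (𝓝 0)) (𝓝 0) :=
    tendsto_comap.mono_left inf_le_left
  have hmem : ∀ᶠ q : ℝ≥0 × E × E in
      alongTimeOffDiag (fun q => ‖q.2.1 - q.2.2‖ ^ (-1 / β) * (q.1 : ℝ)) (𝓝 0),
      0 < q.1 ∧ q.2.1 ≠ q.2.2 := mem_inf_of_right (mem_principal_self _)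
  have hA' : Tendsto (fun q : ℝ≥0 × E × E => ‖q.2.1 - q.2.2‖ ^ (-1 / β) * (q.1 : ℝ))
      (alongTimeOffDiag (fun q => ‖q.2.1 - q.2.2‖ ^ (-1 / β) * (q.1 : ℝ)) (𝓝 0)) (𝓝[>] 0) := by
    refine tendsto_nhdsWithin_iff.2 ⟨hA, ?_⟩
    filter_upwards [hmem] with q hq
    have h1 := norm_pos_iff.2 (sub_ne_zero.2 hq.2)
    have h2 : (0 : ℝ) < q.1 := hq.1
    exact mul_pos (Real.rpow_pos_of_pos h1 _) h2
  refine ((tendsto_rpow_neg_nhdsGT_zero (neg_lt_zero.2 hβ)).comp hA').congr' ?_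
  filter_upwards [hmem] with q hq
  exact rpow_mul_rpow_eq_rpow_neg hβ (norm_pos_iff.2 (sub_ne_zero.2 hq.2)) hq.1

/-! ### Asymptotics of the kernels -/

theorem mainTheorem5 {Ω : Type*} [MeasurableSpace Ω] (P : Measure Ω) [IsProbabilityMeasure P]
    (n : ℕ) (hn : 1 ≤ n) (β : ℝ) (hβ0 : 0 < β) (hβ1 : β < 1)
    (S : ℝ≥0 → Ω → ℝ) (hS : IsStableSubordinator P β S) :
    -- subordination, as `|x - y| t ^ (-1 / β) → ∞`
    ((fun q : ℝ≥0 × EuclideanSpace ℝ (Fin n) × EuclideanSpace ℝ (Fin n) =>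
        timeChangedKernel P (cauchyKernel n) S q.1 q.2.1 q.2.2)
      ~[alongTime (fun q => ‖q.2.1 - q.2.2‖ * (q.1 : ℝ) ^ (-1 / β)) atTop]
      fun q => β * (2 : ℝ) ^ (β - 1) * Real.Gamma (((n : ℝ) + β) / 2) /
          (Real.pi ^ ((n : ℝ) / 2) * Real.Gamma (1 - β / 2)) *
        ‖q.2.1 - q.2.2‖ ^ (-(n : ℝ) - β) * (q.1 : ℝ)) ∧
    -- subordination, as `|x - y| t ^ (-1 / β) → 0`
    ((fun q : ℝ≥0 × EuclideanSpace ℝ (Fin n) × EuclideanSpace ℝ (Fin n) =>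
        timeChangedKernel P (cauchyKernel n) S q.1 q.2.1 q.2.2)
      ~[alongTime (fun q => ‖q.2.1 - q.2.2‖ * (q.1 : ℝ) ^ (-1 / β)) (𝓝 0)]
      fun q => Real.Gamma (((n : ℝ) + 1) / 2) * Real.Gamma ((n : ℝ) / β) /
          (β * Real.pi ^ (((n : ℝ) + 1) / 2) * Real.Gamma (n : ℝ)) *
        (q.1 : ℝ) ^ (-(n : ℝ) / β)) ∧
    -- inverse subordination, as `|x - y| ^ (-1 / β) t → ∞`, dimension one
    (n = 1 →
      (fun q : ℝ≥0 × EuclideanSpace ℝ (Fin n) × EuclideanSpace ℝ (Fin n) =>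
        timeChangedKernel P (cauchyKernel n) (inverseProcess S) q.1 q.2.1 q.2.2)
      ~[alongTimeOffDiag (fun q => ‖q.2.1 - q.2.2‖ ^ (-1 / β) * (q.1 : ℝ)) atTop]
      fun q => β / (Real.pi * Real.Gamma (1 - β)) * (q.1 : ℝ) ^ (-β) *
        Real.log (‖q.2.1 - q.2.2‖ ^ (-1 / β) * (q.1 : ℝ))) ∧
    -- inverse subordination, as `|x - y| ^ (-1 / β) t → ∞`, higher dimensions
    (2 ≤ n →
      (fun q : ℝ≥0 × EuclideanSpace ℝ (Fin n) × EuclideanSpace ℝ (Fin n) =>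
        timeChangedKernel P (cauchyKernel n) (inverseProcess S) q.1 q.2.1 q.2.2)
      ~[alongTimeOffDiag (fun q => ‖q.2.1 - q.2.2‖ ^ (-1 / β) * (q.1 : ℝ)) atTop]
      fun q => Real.Gamma (((n : ℝ) - 1) / 2) /
          (2 * Real.pi ^ (((n : ℝ) + 1) / 2) * Real.Gamma (1 - β)) *
        ‖q.2.1 - q.2.2‖ ^ (1 - (n : ℝ)) * (q.1 : ℝ) ^ (-β)) ∧
    -- inverse subordination, as `|x - y| ^ (-1 / β) t → 0`
    ((fun q : ℝ≥0 × EuclideanSpace ℝ (Fin n) × EuclideanSpace ℝ (Fin n) =>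
        timeChangedKernel P (cauchyKernel n) (inverseProcess S) q.1 q.2.1 q.2.2)
      ~[alongTimeOffDiag (fun q => ‖q.2.1 - q.2.2‖ ^ (-1 / β) * (q.1 : ℝ)) (𝓝 0)]
      fun q => Real.Gamma (((n : ℝ) + 1) / 2) /
          (Real.pi ^ (((n : ℝ) + 1) / 2) * β * Real.Gamma β) *
        ‖q.2.1 - q.2.2‖ ^ (-(n : ℝ) - 1) * (q.1 : ℝ) ^ β) := by
  have hμP := hS.isProbabilityMeasure_map 1
  have hμ := hS.isStableLaw_map_one hβ0
  have hd : (1 : ℝ) ≤ n := by exact_mod_cast hn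
  have hc : 0 < Real.Gamma (((n : ℝ) + 1) / 2) := Real.Gamma_pos_of_pos (by linarith)
  have hG1 : 0 < Real.Gamma (1 - β) := Real.Gamma_pos_of_pos (by linarith)
  have hpi : 0 < Real.pi ^ (((n : ℝ) + 1) / 2) := Real.rpow_pos_of_pos Real.pi_pos _
  refine ⟨?_, ?_, fun hn1 => ?_, fun hn2 => ?_, ?_⟩
  · have hA := (tendsto_comap (f := fun q : ℝ≥0 × EuclideanSpace ℝ (Fin n) ×
      EuclideanSpace ℝ (Fin n) => ‖q.2.1 - q.2.2‖ * (q.1 : ℝ) ^ (-1 / β))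
      (x := atTop)).mono_left (inf_le_left (b := 𝓟 {q | 0 < q.1}))
    refine isEquivalent_of_scaling
      (C := fun q => cauchyConst n * ‖q.2.1 - q.2.2‖ ^ (-(n : ℝ) - β) * (q.1 : ℝ)) hA
      (hμ.tendsto_integral_poissonProfile_atTop hβ0 hβ1 hd) ?_ ?_ ?_
    · have h2 : 0 < Real.Gamma ((1 - β) / 2) := Real.Gamma_pos_of_pos (by linarith)
      have h3 : 0 < Real.Gamma (((n : ℝ) + β) / 2) := Real.Gamma_pos_of_pos (by linarith)
      positivity
    · filter_upwards [hA.eventually_gt_atTop 0, mem_inf_of_right (mem_principal_self _)]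
        with q hq ht
      have ht' : (0 : ℝ) < q.1 := ht
      have hρ : 0 < ‖q.2.1 - q.2.2‖ :=
        (pos_iff_pos_of_mul_pos hq).2 (Real.rpow_pos_of_pos ht' _)
      rw [hS.timeChangedKernel_eq hβ0 ht]
      generalize ∫ z, poissonProfile n (‖q.2.1 - q.2.2‖ * (q.1 : ℝ) ^ (-1 / β)) z ∂(P.map (S 1))
        = G
      have e1 : ‖q.2.1 - q.2.2‖ ^ (-(n : ℝ) - β) * ‖q.2.1 - q.2.2‖ ^ ((n : ℝ) + β) = 1 := by
        rw [← Real.rpow_add hρ, show -(n : ℝ) - β + (n + β) = 0 by ring, Real.rpow_zero]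
      have e2 : (q.1 : ℝ) ^ (-(n : ℝ) / β) = q.1 * (q.1 : ℝ) ^ (-1 / β * ((n : ℝ) + β)) := by
        nth_rewrite 2 [← Real.rpow_one (q.1 : ℝ)]
        rw [← Real.rpow_add ht']
        congr 1
        field_simp
        ring
      rw [Real.mul_rpow hρ.le (by positivity), ← Real.rpow_mul ht'.le, e2]
      linear_combination (-(cauchyConst n * (q.1 * (q.1 : ℝ) ^ (-1 / β * ((n : ℝ) + β)))
        * G)) * e1
    · refine Eventually.of_forall fun q => ?_
      rw [← cauchyConst_mul_subordination_const hd hβ1]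
      ring
  · have hA := (tendsto_comap (f := fun q : ℝ≥0 × EuclideanSpace ℝ (Fin n) ×
      EuclideanSpace ℝ (Fin n) => ‖q.2.1 - q.2.2‖ * (q.1 : ℝ) ^ (-1 / β))
      (x := 𝓝 0)).mono_left (inf_le_left (b := 𝓟 {q | 0 < q.1}))
    have h2 : 0 < Real.Gamma ((n : ℝ) / β) := Real.Gamma_pos_of_pos (by positivity)
    have h3 : 0 < Real.Gamma (n : ℝ) := Real.Gamma_pos_of_pos (by linarith)
    refine isEquivalent_of_scaling
      (C := fun q => cauchyConst n * (q.1 : ℝ) ^ (-(n : ℝ) / β)) hA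
      (hμ.tendsto_integral_poissonProfile_zero hβ0 hd) (by positivity) ?_ ?_
    · filter_upwards [mem_inf_of_right (mem_principal_self _)] with q ht
      exact hS.timeChangedKernel_eq hβ0 ht _ _
    · refine Eventually.of_forall fun q => ?_
      simp only [cauchyConst, pi_rpow_neg_div_two]
      field_simp
  · have hA := tendsto_mul_rpow_neg_of_atTop (E := EuclideanSpace ℝ (Fin n)) hβ0
    have hn1' : (n : ℝ) = 1 := by exact_mod_cast hn1
    have hlog : Tendsto (fun δ : ℝ => -Real.log δ) (𝓝[>] 0) atTop :=
      tendsto_neg_atBot_atTop.comp Real.tendsto_log_nhdsGT_zero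
    refine isEquivalent_of_scaling (C := fun q => Real.pi⁻¹ * (q.1 : ℝ) ^ (-β)
        * -Real.log (‖q.2.1 - q.2.2‖ * (q.1 : ℝ) ^ (-β))) hA
      (hμ.tendsto_integral_poissonProfile_one_div_log hβ0 hβ1) (by positivity) ?_ ?_
    · filter_upwards [mem_inf_of_right (mem_principal_self _),
        (hlog.comp hA).eventually_gt_atTop 0] with q hq hl
      rw [hS.timeChangedKernel_inverseProcess_eq hβ0 hq.1, hn1']
      have hc1 : cauchyConst 1 = Real.pi⁻¹ := by
        unfold cauchyConst
        norm_num [Real.rpow_neg_one]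
      rw [Function.comp_apply] at hl
      rw [hc1, neg_one_mul]
      generalize -Real.log (‖q.2.1 - q.2.2‖ * (q.1 : ℝ) ^ (-β)) = m at hl ⊢
      field_simp
    · filter_upwards [mem_inf_of_right (mem_principal_self _)] with q hq
      have ht : (0 : ℝ) < q.1 := hq.1
      have hρ : 0 < ‖q.2.1 - q.2.2‖ := norm_pos_iff.2 (sub_ne_zero.2 hq.2)
      rw [← rpow_mul_rpow_eq_rpow_neg hβ0 hρ ht, Real.log_rpow (by positivity)]
      field_simp
  · have hA := tendsto_mul_rpow_neg_of_atTop (E := EuclideanSpace ℝ (Fin n)) hβ0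
    have hd2 : (1 : ℝ) < n := by exact_mod_cast hn2
    have hd2' : (n : ℝ) - 1 ≠ 0 := by linarith
    refine isEquivalent_of_scaling
      (C := fun q => cauchyConst n * ‖q.2.1 - q.2.2‖ ^ (1 - (n : ℝ)) * (q.1 : ℝ) ^ (-β)) hA
      (hμ.tendsto_rpow_mul_integral_poissonProfile_rpow hβ0 hβ1 hd2) (by positivity) ?_ ?_
    · filter_upwards [mem_inf_of_right (mem_principal_self _)] with q hq
      have ht : (0 : ℝ) < q.1 := hq.1
      have hρ : 0 < ‖q.2.1 - q.2.2‖ := norm_pos_iff.2 (sub_ne_zero.2 hq.2)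
      rw [hS.timeChangedKernel_inverseProcess_eq hβ0 hq.1]
      generalize ∫ z, poissonProfile n (‖q.2.1 - q.2.2‖ * (q.1 : ℝ) ^ (-β)) (z ^ (-β))
        ∂(P.map (S 1)) = G
      have e1 : ‖q.2.1 - q.2.2‖ ^ (1 - (n : ℝ)) * ‖q.2.1 - q.2.2‖ ^ ((n : ℝ) - 1) = 1 := by
        rw [← Real.rpow_add hρ, show 1 - (n : ℝ) + (n - 1) = 0 by ring, Real.rpow_zero]
      have e2 : (q.1 : ℝ) ^ (-(n : ℝ) * β)
          = (q.1 : ℝ) ^ (-β) * (q.1 : ℝ) ^ (-β * ((n : ℝ) - 1)) := by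
        rw [← Real.rpow_add ht]
        ring_nf
      rw [Real.mul_rpow hρ.le (by positivity), ← Real.rpow_mul ht.le, e2]
      linear_combination (-(cauchyConst n * ((q.1 : ℝ) ^ (-β) * (q.1 : ℝ) ^ (-β * ((n : ℝ) - 1)))
        * G)) * e1
    · refine Eventually.of_forall fun q => ?_
      have hg : Real.Gamma (((n : ℝ) + 1) / 2)
          = ((n : ℝ) - 1) / 2 * Real.Gamma (((n : ℝ) - 1) / 2) := by
        rw [← Real.Gamma_add_one (by linarith : ((n : ℝ) - 1) / 2 ≠ 0)]
        ring_nf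
      simp only [cauchyConst, pi_rpow_neg_div_two]
      rw [hg]
      field_simp
  · have hA := tendsto_mul_rpow_neg_of_zero (E := EuclideanSpace ℝ (Fin n)) hβ0
    have hG : 0 < Real.Gamma β := Real.Gamma_pos_of_pos hβ0
    refine isEquivalent_of_scaling
      (C := fun q => cauchyConst n * ‖q.2.1 - q.2.2‖ ^ (-(n : ℝ) - 1) * (q.1 : ℝ) ^ β) hA
      (hμ.tendsto_integral_poissonProfile_rpow_atTop hβ0 hd) (by positivity) ?_ ?_
    · filter_upwards [mem_inf_of_right (mem_principal_self _)] with q hq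
      have ht : (0 : ℝ) < q.1 := hq.1
      have hρ : 0 < ‖q.2.1 - q.2.2‖ := norm_pos_iff.2 (sub_ne_zero.2 hq.2)
      rw [hS.timeChangedKernel_inverseProcess_eq hβ0 hq.1]
      generalize ∫ z, poissonProfile n (‖q.2.1 - q.2.2‖ * (q.1 : ℝ) ^ (-β)) (z ^ (-β))
        ∂(P.map (S 1)) = G
      have e1 : ‖q.2.1 - q.2.2‖ ^ (-(n : ℝ) - 1) * ‖q.2.1 - q.2.2‖ ^ ((n : ℝ) + 1) = 1 := by
        rw [← Real.rpow_add hρ, show -(n : ℝ) - 1 + (n + 1) = 0 by ring, Real.rpow_zero]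
      have e2 : (q.1 : ℝ) ^ (-(n : ℝ) * β)
          = (q.1 : ℝ) ^ β * (q.1 : ℝ) ^ (-β * ((n : ℝ) + 1)) := by
        rw [← Real.rpow_add ht]
        ring_nf
      rw [Real.mul_rpow hρ.le (by positivity), ← Real.rpow_mul ht.le, e2]
      linear_combination (-(cauchyConst n * ((q.1 : ℝ) ^ β * (q.1 : ℝ) ^ (-β * ((n : ℝ) + 1)))
        * G)) * e1
    · refine Eventually.of_forall fun q => ?_
      simp only [cauchyConst, pi_rpow_neg_div_two]
      field_simp
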